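/- Let $n_1,n_2,\dots\ge 1$ be integers, $N_0=0$ and $N_t=n_1+\cdots+n_t$, and let $S(n_1,\dots,n_t)$ be the set of permutations (arrangements in a row) of the multiset with $n_i$ copies of $i$, $1\le i\le t$. Every multiset permutation $\pi$ is uniquely an intercalation product of cycles $(x_{1,1}\ldots x_{1,m_1}\,y_1)\perp\cdots\perp(x_{r,1}\ldots x_{r,m_r}\,y_r)$ with $m_i\ge 0$, $y_1\le\cdots\le y_r$ and $y_i<x_{i,j}$ for all $i,j$; here the cycle $(x_1\ldots x_m)$ is the multiset permutation whose two-line notation is obtained by stably sorting the columns $\binom{x_1}{x_2},\dots,\binom{x_{m-1}}{x_m},\binom{x_m}{x_1}$ by their top entries, and $\perp$ juxtaposes two-line notations and stably sorts the columns by their top entries. The number of cycles of $\pi$ is $r$. For $\theta>0$ the multiset Chinese restaurant process is the Markov chain $\tilde\Pi_0=\emptyset,\tilde\Pi_1,\tilde\Pi_2,\dots$ with $\tilde\Pi_t\in S(n_1,\dots,n_t)$ in which, at step $t$, each particular way of placing the $n_t$ copies of $t$ so that $k$ of them ($0\le k\le n_t$) form new singleton cycles and the other $n_t-k$ are inserted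 to the left of letters in the cycles of $\tilde\Pi_{t-1}$ has probability $\theta^k/F_t(\theta)$, where $F_t(\theta)=\sum_{k=0}^{n_t}\binom{N_{t-1}-1+n_t-k}{n_t-k}\theta^k$, with the conventions $\binom{-1}{0}=1$ and $\binom{m-1}{m}=0$ for $m\ge 1$. Let $K_t$ be the number of cycles of $\tilde\Pi_t$. Theorem. Take $\theta=1$, and suppose that there is a constant $C$ with $n_t\le C N_{t-1}$ for all $t\ge 2$ and that $\sum_{t=2}^\infty n_t/N_{t-1}=\infty$ (so $n_t$ may be unbounded). Then, as $t\to\infty$, $$\frac{K_t}{\mathbb E K_t}\to 1\ \text{ almost surely}\qquad\text{and}\qquad \frac{K_t-\mathbb E K_t}{\sqrt{\operatorname{Var}(K_t)}}\ \xrightarrow{d}\ \mathrm N(0,1).$$ -/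

import Mathlib

open MeasureTheory ProbabilityTheory Filter Topology

namespace MultisetCRP

/-! Multiset permutations are words `w : List ℕ` in the letters `1, 2, …`. -/

/-- The two-line notation of a word, as the list of its columns `(top, bottom)`. -/
def twoLine (w : List ℕ) : List (ℕ × ℕ) := (w.insertionSort (· ≤ ·)).zip w

/-- Sort a list of columns stably into nondecreasing order of the top line. -/
def stableSort (L : List (ℕ × ℕ)) : List (ℕ × ℕ) :=
  L.insertionSort (fun p q => p.1 ≤ q.1)

/-- The intercalation product of two multiset permutations. -/
def intercalation (w v : List ℕ) : List ℕ :=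
  (stableSort (twoLine w ++ twoLine v)).map Prod.snd

/-- The multiset permutation denoted by the cycle `(x₁ x₂ … xₘ)`: stably sort the columns
`(x₁, x₂), (x₂, x₃), …, (xₘ, x₁)`. -/
def cycle (x : List ℕ) : List ℕ := (stableSort (x.zip (x.rotate 1))).map Prod.snd

/-- The word `x₁ … xₘ y` of a cycle that is given as the pair `([x₁, …, xₘ], y)`. -/
def cycleWord (p : List ℕ × ℕ) : List ℕ := p.1 ++ [p.2]

/-- The intercalation product of a list of cycles. -/
def cycleProd (c : List (List ℕ × ℕ)) : List ℕ :=
  (c.map fun p => cycle (cycleWord p)).foldr intercalation []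

/-- `c` is a cycle factorisation of the word `w`:
`w = (x₁₁ … y₁) ⊥ (x₂₁ … y₂) ⊥ ⋯` with `y₁ ≤ y₂ ≤ ⋯` and `yᵢ < xᵢⱼ`. -/
structure IsCycleFactorisation (w : List ℕ) (c : List (List ℕ × ℕ)) : Prop where
  prod_eq : cycleProd c = w
  sorted : (c.map Prod.snd).Pairwise (· ≤ ·)
  lt : ∀ p ∈ c, ∀ x ∈ p.1, p.2 < x

/-! Existence and uniqueness of the cycle factorisation. -/

/-- The two lists of columns have, for every top entry, the same columns in the same order. -/
def ColEq (L M : List (ℕ × ℕ)) : Prop :=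
  ∀ a : ℕ, L.filter (fun p => p.1 = a) = M.filter (fun p => p.1 = a)

theorem ColEq.refl (L : List (ℕ × ℕ)) : ColEq L L := fun _ => rfl

theorem ColEq.symm {L M : List (ℕ × ℕ)} (h : ColEq L M) : ColEq M L := fun a => (h a).symm

theorem ColEq.trans {L M K : List (ℕ × ℕ)} (h : ColEq L M) (h' : ColEq M K) : ColEq L K :=
  fun a => (h a).trans (h' a)

theorem ColEq.append {L M L' M' : List (ℕ × ℕ)} (h : ColEq L M) (h' : ColEq L' M') :
    ColEq (L ++ L') (M ++ M') := fun a => by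
  rw [List.filter_append, List.filter_append, h a, h' a]

theorem ColEq.cons {L M : List (ℕ × ℕ)} (p : ℕ × ℕ) (h : ColEq L M) :
    ColEq (p :: L) (p :: M) := ColEq.append (ColEq.refl [p]) h

theorem ColEq.cons_inv {L M : List (ℕ × ℕ)} {v a b : ℕ}
    (h : ColEq ((v, a) :: L) ((v, b) :: M)) : a = b ∧ ColEq L M := by
  have hv := h v
  simp only [List.filter_cons, decide_true, if_true, List.cons.injEq, Prod.mk.injEq,
    true_and] at hv
  refine ⟨hv.1, fun c => ?_⟩
  by_cases hc : v = c
  · subst hc; exact hv.2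
  · simpa [List.filter_cons, hc] using h c

theorem ColEq.perm {L M : List (ℕ × ℕ)} (h : ColEq L M) : L.Perm M := by
  rw [List.perm_iff_count]
  intro p
  have := congrArg (List.count p) (h p.1)
  rwa [List.count_filter (by simp), List.count_filter (by simp)] at this

theorem colEq_orderedInsert (p : ℕ × ℕ) (L : List (ℕ × ℕ)) :
    ColEq (L.orderedInsert (fun p q => p.1 ≤ q.1) p) (p :: L) := by
  induction L with
  | nil => exact ColEq.refl _
  | cons q L ih =>
    rw [List.orderedInsert_cons]
    split_ifs with h
    · exact ColEq.refl _
    · refine (ih.cons q).trans fun a => ?_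
      by_cases h1 : p.1 = a <;> by_cases h2 : q.1 = a <;> simp [h1, h2]
      omega

theorem colEq_stableSort (L : List (ℕ × ℕ)) : ColEq (stableSort L) L := by
  induction L with
  | nil => exact ColEq.refl _
  | cons p L ih =>
    exact (colEq_orderedInsert p _).trans (ih.cons p)

theorem pairwise_stableSort (L : List (ℕ × ℕ)) :
    (stableSort L).Pairwise (fun p q => p.1 ≤ q.1) := by
  have : Std.Total (fun p q : ℕ × ℕ => p.1 ≤ q.1) := ⟨fun p q => le_total p.1 q.1⟩
  have : IsTrans (ℕ × ℕ) (fun p q => p.1 ≤ q.1) := ⟨fun _ _ _ h h' => le_trans h h'⟩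
  exact List.pairwise_insertionSort _ L

theorem ColEq.eq_of_pairwise {L M : List (ℕ × ℕ)} (h : ColEq L M)
    (hL : L.Pairwise (fun p q => p.1 ≤ q.1)) (hM : M.Pairwise (fun p q => p.1 ≤ q.1)) :
    L = M := by
  induction L generalizing M with
  | nil => exact (List.nil_perm.1 h.perm).symm
  | cons p L ih =>
    cases M with
    | nil => exact absurd h.perm (by simp)
    | cons q M =>
      rw [List.pairwise_cons] at hL hM
      have h1 : p.1 ≤ q.1 := by
        rcases List.mem_cons.1 (h.perm.mem_iff.2 List.mem_cons_self) with e | e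
        · rw [e]
        · exact hL.1 _ e
      have h2 : q.1 ≤ p.1 := by
        rcases List.mem_cons.1 (h.perm.mem_iff.1 List.mem_cons_self) with e | e
        · rw [e]
        · exact hM.1 _ e
      obtain ⟨v, a⟩ := p
      obtain ⟨u, b⟩ := q
      obtain rfl : v = u := le_antisymm h1 h2
      obtain ⟨rfl, h'⟩ := h.cons_inv
      rw [ih h' hL.2 hM.2]

theorem map_fst_twoLine (w : List ℕ) : (twoLine w).map Prod.fst = w.insertionSort (· ≤ ·) :=
  List.map_fst_zip (by simp)

theorem map_snd_twoLine (w : List ℕ) : (twoLine w).map Prod.snd = w :=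
  List.map_snd_zip (by simp)

theorem twoLine_balanced (w : List ℕ) :
    ((twoLine w).map Prod.fst).Perm ((twoLine w).map Prod.snd) := by
  rw [map_fst_twoLine, map_snd_twoLine]
  exact List.perm_insertionSort _ _

theorem pairwise_twoLine (w : List ℕ) : (twoLine w).Pairwise (fun p q => p.1 ≤ q.1) := by
  have h := List.pairwise_insertionSort (· ≤ ·) w
  rw [← map_fst_twoLine, List.pairwise_map] at h
  exact h

theorem twoLine_map_snd {L : List (ℕ × ℕ)} (hL : L.Pairwise (fun p q => p.1 ≤ q.1))
    (hb : (L.map Prod.fst).Perm (L.map Prod.snd)) : twoLine (L.map Prod.snd) = L := by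
  have : (L.map Prod.snd).insertionSort (· ≤ ·) = L.map Prod.fst := by
    refine List.Perm.eq_of_pairwise (le := (· ≤ ·)) (fun a b _ _ h h' => le_antisymm h h')
      (List.pairwise_insertionSort _ _) (List.pairwise_map.2 hL) ?_
    exact (List.perm_insertionSort _ _).trans hb.symm
  rw [twoLine, this, List.zip_map', List.map_id'']
  simp

theorem twoLine_map_snd_stableSort {L : List (ℕ × ℕ)}
    (hb : (L.map Prod.fst).Perm (L.map Prod.snd)) :
    ColEq (twoLine ((stableSort L).map Prod.snd)) L := by
  have hp := (colEq_stableSort L).perm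
  rw [twoLine_map_snd (pairwise_stableSort L)
    (((hp.map _).trans hb).trans (hp.map _).symm)]
  exact colEq_stableSort L

/-- The columns `(v, x₁), (x₁, x₂), …, (xₘ, y)`. -/
def path : ℕ → List ℕ → ℕ → List (ℕ × ℕ)
  | v, [], y => [(v, y)]
  | v, a :: x, y => (v, a) :: path a x y

theorem map_fst_path (v : ℕ) (x : List ℕ) (y : ℕ) : (path v x y).map Prod.fst = v :: x := by
  induction x generalizing v with
  | nil => rfl
  | cons a x ih => simp [path, ih]

theorem map_snd_path (v : ℕ) (x : List ℕ) (y : ℕ) :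
    (path v x y).map Prod.snd = x ++ [y] := by
  induction x generalizing v with
  | nil => rfl
  | cons a x ih => simp [path, ih]

theorem path_concat (v : ℕ) (x : List ℕ) (y z : ℕ) :
    path v (x ++ [y]) z = path v x y ++ [(y, z)] := by
  induction x generalizing v with
  | nil => rfl
  | cons a x ih => simp [path, ih]

theorem zip_path (v : ℕ) (x : List ℕ) (y : ℕ) : (v :: x).zip (x ++ [y]) = path v x y := by
  induction x generalizing v with
  | nil => rfl
  | cons a x ih => simp [path, ih]

theorem colEq_rotate (x : List ℕ) (y : ℕ) (h : y ∉ x) :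
    ColEq ((x ++ [y]).zip ((x ++ [y]).rotate 1)) (path y x y) := by
  cases x with
  | nil => simpa [path] using ColEq.refl [(y, y)]
  | cons a x =>
    have e : ((a :: x) ++ [y]).zip (((a :: x) ++ [y]).rotate 1) = path a x y ++ [(y, a)] := by
      rw [← path_concat, List.cons_append, List.rotate_cons_succ, List.rotate_zero, zip_path]
    rw [e]
    intro c
    by_cases hc : y = c
    · subst hc
      have : (path a x y).filter (fun p => p.1 = y) = [] := by
        rw [List.filter_eq_nil_iff]
        intro p hp
        have h' : p.1 ∈ a :: x := map_fst_path a x y ▸ List.mem_map_of_mem hp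
        simp only [decide_eq_true_eq]
        rintro rfl
        exact h h'
      simp [path, List.filter_append, this]
    · simp [path, List.filter_append, hc]

theorem ColEq.path_inv {x x' : List ℕ} {v y : ℕ} {R R' : List (ℕ × ℕ)} (hx : y ∉ x)
    (hx' : y ∉ x') (h : ColEq (path v x y ++ R) (path v x' y ++ R')) :
    x = x' ∧ ColEq R R' := by
  induction x generalizing v x' with
  | nil =>
    cases x' with
    | nil => exact ⟨rfl, h.cons_inv.2⟩
    | cons a' x' => exact absurd h.cons_inv.1 (by rintro rfl; simp at hx')
  | cons a x ih =>
    cases x' with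
    | nil => exact absurd h.cons_inv.1 (by rintro rfl; simp at hx)
    | cons a' x' =>
      obtain ⟨rfl, h'⟩ := h.cons_inv
      obtain ⟨rfl, h''⟩ := ih (by simp_all) (by simp_all) h'
      exact ⟨rfl, h''⟩

/-- All columns of the cycles of `c`. -/
def columns (c : List (List ℕ × ℕ)) : List (ℕ × ℕ) := c.flatMap fun p => path p.2 p.1 p.2

theorem twoLine_cycleProd {c : List (List ℕ × ℕ)} (hc : ∀ p ∈ c, ∀ x ∈ p.1, p.2 < x) :
    ColEq (twoLine (cycleProd c)) (columns c) := by
  induction c with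
  | nil => exact ColEq.refl _
  | cons p c ih =>
    have ih' := ih fun q hq => hc q (List.mem_cons_of_mem _ hq)
    have hp : p.2 ∉ p.1 := fun h => lt_irrefl _ (hc p List.mem_cons_self _ h)
    have e : ColEq (twoLine (cycle (cycleWord p))) (path p.2 p.1 p.2) := by
      refine (twoLine_map_snd_stableSort ?_).trans (colEq_rotate _ _ hp)
      rw [List.map_fst_zip (by simp), List.map_snd_zip (by simp)]
      exact (List.rotate_perm _ _).symm
    refine (twoLine_map_snd_stableSort ?_).trans (e.append ih')
    rw [List.map_append, List.map_append]
    exact (twoLine_balanced _).append (twoLine_balanced _)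

theorem cycleProd_eq_iff {w : List ℕ} {c : List (List ℕ × ℕ)}
    (hc : ∀ p ∈ c, ∀ x ∈ p.1, p.2 < x) :
    cycleProd c = w ↔ ColEq (columns c) (twoLine w) := by
  constructor
  · rintro rfl
    exact (twoLine_cycleProd hc).symm
  · intro h
    have := ((twoLine_cycleProd hc).trans h).eq_of_pairwise (pairwise_twoLine _)
      (pairwise_twoLine _)
    rw [← map_snd_twoLine (cycleProd c), this, map_snd_twoLine]

theorem exists_snd_le {c : List (List ℕ × ℕ)} (hc : ∀ p ∈ c, ∀ x ∈ p.1, p.2 < x) {v : ℕ}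
    (hv : v ∈ (columns c).map Prod.fst) : ∃ p ∈ c, p.2 ≤ v := by
  simp only [columns, List.map_flatMap, map_fst_path, List.mem_flatMap, List.mem_cons] at hv
  obtain ⟨p, hp, h | h⟩ := hv
  · exact ⟨p, hp, h.ge⟩
  · exact ⟨p, hp, (hc p hp v h).le⟩

theorem columns_injective {c c' : List (List ℕ × ℕ)} (hs : (c.map Prod.snd).Pairwise (· ≤ ·))
    (hs' : (c'.map Prod.snd).Pairwise (· ≤ ·)) (hc : ∀ p ∈ c, ∀ x ∈ p.1, p.2 < x)
    (hc' : ∀ p ∈ c', ∀ x ∈ p.1, p.2 < x) (h : ColEq (columns c) (columns c')) : c = c' := by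
  have key : ∀ {p q : List ℕ × ℕ} {c c' : List (List ℕ × ℕ)},
      ((q :: c').map Prod.snd).Pairwise (· ≤ ·) → (∀ p ∈ q :: c', ∀ x ∈ p.1, p.2 < x) →
      ColEq (columns (p :: c)) (columns (q :: c')) → q.2 ≤ p.2 := by
    intro p q c c' hs' hc' h
    have hm : p.2 ∈ (columns (p :: c)).map Prod.fst := by
      simp [columns, map_fst_path]
    obtain ⟨r, hr, hle⟩ := exists_snd_le hc' ((h.perm.map _).mem_iff.1 hm)
    rcases List.mem_cons.1 hr with rfl | hr
    · exact hle
    · rw [List.map_cons, List.pairwise_cons] at hs'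
      exact (hs'.1 _ (List.mem_map_of_mem hr)).trans hle
  induction c generalizing c' with
  | nil =>
    cases c' with
    | nil => rfl
    | cons q c' =>
      have := (h.perm.map Prod.fst).length_eq
      simp [columns, map_fst_path] at this
  | cons p c ih =>
    cases c' with
    | nil =>
      have := (h.perm.map Prod.fst).length_eq
      simp [columns, map_fst_path] at this
    | cons q c' =>
      obtain ⟨x, y⟩ := p
      obtain ⟨x', y'⟩ := q
      obtain rfl : y = y' := le_antisymm (key hs hc h.symm) (key hs' hc' h)
      have hy : y ∉ x := fun h => lt_irrefl _ (hc (x, y) List.mem_cons_self _ h)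
      have hy' : y ∉ x' := fun h => lt_irrefl _ (hc' (x', y) List.mem_cons_self _ h)
      obtain ⟨rfl, h'⟩ := ColEq.path_inv hy hy' h
      rw [ih (List.pairwise_cons.1 hs).2 (List.pairwise_cons.1 hs').2
        (fun p hp => hc p (List.mem_cons_of_mem _ hp))
        (fun p hp => hc' p (List.mem_cons_of_mem _ hp)) h']

theorem exists_pop {L : List (ℕ × ℕ)} {v : ℕ} (hv : v ∈ L.map Prod.fst) :
    ∃ a M, ColEq L ((v, a) :: M) := by
  induction L with
  | nil => simp at hv
  | cons p L ih =>
    by_cases hp : p.1 = v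
    · subst hp
      exact ⟨p.2, L, ColEq.refl _⟩
    · obtain ⟨a, M, h⟩ := ih (by simpa [Ne.symm hp] using hv)
      refine ⟨a, p :: M, (h.cons p).trans fun c => ?_⟩
      by_cases h1 : p.1 = c <;> by_cases h2 : v = c <;> simp [h1, h2]
      exact absurd (h1.trans h2.symm) hp

theorem exists_path (n : ℕ) {L : List (ℕ × ℕ)} {v y : ℕ} (hn : L.length = n)
    (hb : (y :: L.map Prod.fst).Perm (v :: L.map Prod.snd)) (hv : v ≠ y) :
    ∃ x R, ColEq L (path v x y ++ R) ∧ y ∉ x ∧ (R.map Prod.fst).Perm (R.map Prod.snd) := by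
  induction n generalizing L v with
  | zero =>
    obtain rfl := List.length_eq_zero_iff.1 hn
    simp at hb
    exact absurd hb.symm hv
  | succ n ih =>
    have hm : v ∈ L.map Prod.fst := by
      have := hb.mem_iff.2 (List.mem_cons_self (a := v))
      simpa [hv] using this
    obtain ⟨a, M, h⟩ := exists_pop hm
    have h1 := h.perm.map Prod.fst
    have h2 := h.perm.map Prod.snd
    simp only [List.map_cons] at h1 h2
    have hb' : (y :: M.map Prod.fst).Perm (a :: M.map Prod.snd) := by
      have h3 := ((h1.cons y).symm.trans hb).trans (h2.cons v)
      exact ((List.Perm.swap y v _).trans h3).cons_inv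
    by_cases ha : a = y
    · subst ha
      exact ⟨[], M, h, by simp, hb'.cons_inv⟩
    · have hl := h.perm.length_eq
      obtain ⟨x, R, hR, hy, hRb⟩ := ih (L := M) (by simp at hl; omega) hb' ha
      exact ⟨a :: x, R, h.trans (hR.cons _), by simp [Ne.symm ha, hy], hRb⟩

theorem exists_columns (n : ℕ) {L : List (ℕ × ℕ)} (hn : L.length = n)
    (hb : (L.map Prod.fst).Perm (L.map Prod.snd)) :
    ∃ c : List (List ℕ × ℕ), ColEq (columns c) L ∧ (c.map Prod.snd).Pairwise (· ≤ ·) ∧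
      ∀ p ∈ c, ∀ x ∈ p.1, p.2 < x := by
  induction n using Nat.strong_induction_on generalizing L with
  | _ n ih =>
    by_cases h0 : L = []
    · subst h0
      exact ⟨[], ColEq.refl _, by simp, by simp⟩
    have hex : ∃ y, y ∈ L.map Prod.fst := by
      obtain ⟨p, hp⟩ := List.exists_mem_of_ne_nil L h0
      exact ⟨p.1, List.mem_map_of_mem hp⟩
    classical
    let y := Nat.find hex
    have hy : y ∈ L.map Prod.fst := Nat.find_spec hex
    have hmin : ∀ z ∈ L.map Prod.fst, y ≤ z := fun z hz => Nat.find_min' hex hz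
    have main : ∃ x R, ColEq L (path y x y ++ R) ∧ y ∉ x ∧
        (R.map Prod.fst).Perm (R.map Prod.snd) := by
      obtain ⟨a, M, h⟩ := exists_pop hy
      have h1 := h.perm.map Prod.fst
      have h2 := h.perm.map Prod.snd
      simp only [List.map_cons] at h1 h2
      have hb' : (y :: M.map Prod.fst).Perm (a :: M.map Prod.snd) :=
        (h1.symm.trans hb).trans h2
      by_cases ha : a = y
      · rw [ha] at h hb'
        exact ⟨[], M, h, by simp, hb'.cons_inv⟩
      · obtain ⟨x, R, hR, hx, hRb⟩ := exists_path _ rfl hb' ha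
        exact ⟨a :: x, R, h.trans (hR.cons _), by simp [Ne.symm ha, hx], hRb⟩
    obtain ⟨x, R, hR, hx, hRb⟩ := main
    have hperm := hR.perm.map Prod.fst
    rw [List.map_append, map_fst_path] at hperm
    have hlen : R.length < n := by
      have := hperm.length_eq
      simp at this
      omega
    obtain ⟨c, hc, hs, hlt⟩ := ih _ hlen rfl hRb
    refine ⟨(x, y) :: c, (((ColEq.refl (path y x y)).append hc).trans hR.symm), ?_, ?_⟩
    · rw [List.map_cons, List.pairwise_cons]
      refine ⟨fun z hz => hmin z ?_, hs⟩
      rw [hperm.mem_iff, List.mem_append]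
      right
      rw [← (hc.perm.map Prod.fst).mem_iff]
      obtain ⟨p, hp, rfl⟩ := List.mem_map.1 hz
      simp only [columns, List.map_flatMap, map_fst_path, List.mem_flatMap]
      exact ⟨p, hp, List.mem_cons_self⟩
    · intro p hp z hz
      rcases List.mem_cons.1 hp with rfl | hp
      · refine lt_of_le_of_ne (hmin z ?_) ?_
        · rw [hperm.mem_iff]
          simp only [List.cons_append, List.mem_cons, List.mem_append]
          exact Or.inr (Or.inl hz)
        · intro e
          apply hx
          have e' : y = z := e
          rw [e']
          exact hz
      · exact hlt p hp z hz

/-- Every word has exactly one cycle factorisation. -/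
theorem existsUnique_isCycleFactorisation (w : List ℕ) : ∃! c, IsCycleFactorisation w c := by
  obtain ⟨c, hc, hs, hlt⟩ := exists_columns _ rfl (twoLine_balanced w)
  refine ⟨c, ⟨(cycleProd_eq_iff hlt).2 hc, hs, hlt⟩, fun c' h => ?_⟩
  exact columns_injective h.sorted hs h.lt hlt
    (((cycleProd_eq_iff h.lt).1 h.prod_eq).trans hc.symm)

/-- The cycle factorisation of a word. -/
noncomputable def cycles (w : List ℕ) : List (List ℕ × ℕ) :=
  (existsUnique_isCycleFactorisation w).choose

theorem isCycleFactorisation_cycles (w : List ℕ) : IsCycleFactorisation w (cycles w) :=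
  (existsUnique_isCycleFactorisation w).choose_spec.1

/-- The number of cycles `|w|`. -/
noncomputable def numCycles (w : List ℕ) : ℕ := (cycles w).length

/-! The Chinese restaurant process. Only the values `n 1, n 2, …` of a sequence `n` are used. -/

/-- `N_t = n_1 + ⋯ + n_t`. -/
def total (n : ℕ → ℕ) (t : ℕ) : ℕ := ∑ i ∈ Finset.Icc 1 t, n i

/-- The set `S(n_1, …, n_t)` of permutations of the multiset with `n_i` copies of `i`,
`1 ≤ i ≤ t`. -/
def MultisetPerm (n : ℕ → ℕ) (t : ℕ) : Type :=
  {w : List ℕ // (w : Multiset ℕ) = ∑ i ∈ Finset.Icc 1 t, Multiset.replicate (n i) i}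

/-- `InsertLeft a x x'`: the word `x'` arises from `x` by inserting copies of `a`, each to the
left of some letter of `x`. -/
inductive InsertLeft (a : ℕ) : List ℕ → List ℕ → Prop
  | nil : InsertLeft a [] []
  | cons (j b : ℕ) {x x' : List ℕ} (h : InsertLeft a x x') :
      InsertLeft a (b :: x) (List.replicate j a ++ b :: x')

/-- `IsExtension t m k c c'`: the list of cycles `c'` arises from `c` by placing `m` copies of
`t`, of which `k` form new singleton cycles and the others are inserted to the left of letters
in the cycles of `c`. -/
def IsExtension (t m k : ℕ) (c c' : List (List ℕ × ℕ)) : Prop :=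
  ∃ d : List (List ℕ × ℕ),
    List.Forall₂ (fun p q => InsertLeft t (cycleWord p) (cycleWord q)) c d ∧
    c' = d ++ List.replicate k ([], t) ∧
    (c'.flatMap cycleWord).count t = m

/-- `F_t(θ) = ∑_{k=0}^{n_t} binom(N_{t-1} - 1 + n_t - k, n_t - k) θ^k`; the binomial coefficient
is the number of multisets of size `n_t - k` in a set of size `N_{t-1}`. -/
noncomputable def weight (n : ℕ → ℕ) (θ : ℝ) (t : ℕ) : ℝ :=
  ∑ k ∈ Finset.range (n t + 1), (Nat.multichoose (total n (t - 1)) (n t - k) : ℝ) * θ ^ k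

open Classical in
/-- The probability that step `t` of the process leads from `w` to `w'`: it is `θ ^ k / F_t(θ)`
if `w'` extends `w` with `k` new singleton cycles, and `0` if `w'` does not extend `w`. At most
one term of the sum is nonzero. -/
noncomputable def transProb (n : ℕ → ℕ) (θ : ℝ) (t : ℕ) (w w' : List ℕ) : ℝ :=
  ∑ k ∈ Finset.range (n t + 1),
    if IsExtension t (n t) k (cycles w) (cycles w') then θ ^ k / weight n θ t else 0

/-- `π` is a Chinese restaurant process on the permutations of the multisets with multiplicities
`n_1, n_2, …` and with parameter `θ`: the Markov chain, starting at the empty permutation, with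
the above transition probabilities. -/
structure IsMultisetCRP {Ω : Type*} [MeasurableSpace Ω] (P : Measure Ω) (n : ℕ → ℕ) (θ : ℝ)
    (π : (t : ℕ) → Ω → MultisetPerm n t) : Prop where
  measurableSet_eq : ∀ (t : ℕ) (w : MultisetPerm n t), MeasurableSet {ω | π t ω = w}
  law : ∀ (t : ℕ) (w : (s : ℕ) → MultisetPerm n s),
    P.real {ω | ∀ s ≤ t, π s ω = w s} =
      ∏ s ∈ Finset.range t, transProb n θ (s + 1) (w s).1 (w (s + 1)).1

/-- The number `K_t` of cycles at step `t`. -/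
noncomputable def cycleCount {Ω : Type*} {n : ℕ → ℕ} (π : (t : ℕ) → Ω → MultisetPerm n t)
    (t : ℕ) (ω : Ω) : ℝ := (numCycles (π t ω).1 : ℝ)

end MultisetCRP

namespace MultisetCRP

/-! Inserting copies of the new largest letter to the left of letters keeps the last letter of every
cycle and its minimality, and new singletons of that letter belong at the end. So an extended list
of cycles is again a cycle factorisation, of exactly one word. By stars and bars, `n - k` copies can
be inserted among `N` letters in `multichoose N (n - k)` ways, whatever the current permutation is
(`encard_extensions`). Hence the number of cycles formed in a step is independent of the past, and
`K_t` is a sum of independent variables. This is used in the form of `integral_numCycles_succ`, a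
recursion for the expectation of any function of `K_t`.

For θ = 1 a step throws `n` balls into `N + 1` boxes with Bose–Einstein statistics, the extra box
standing for the new cycles. The factorial moments have a closed form. With mean e = n/(N+1), the
variance is e(1+e)N/(N+2) and the third absolute central moment is at most 7e³+6e²+e. The first step
is deterministic because `N_0 = 0`. Later e ≤ C, so the variance is comparable to the mean and
bounds the third moment up to a constant. The divergence of the series then sends both mean and
variance of `K_t` to infinity.

The strong law follows from second moments along the times at which the mean passes the squares, and
from monotonicity of `K_t` in between (`ae_tendsto_div_of_variance_le`). The normal limit is
Lyapunov's theorem, proved with characteristic functions (`tendsto_prod_charFun`). -/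

/-! ### Insertions into cycles and their number -/

theorem map_snd_columns (c : List (List ℕ × ℕ)) :
    (columns c).map Prod.snd = c.flatMap cycleWord := by
  simp only [columns, List.map_flatMap, map_snd_path]
  rfl

theorem IsCycleFactorisation.perm {w : List ℕ} {c : List (List ℕ × ℕ)}
    (h : IsCycleFactorisation w c) : (c.flatMap cycleWord).Perm w := by
  have := (((cycleProd_eq_iff h.lt).1 h.prod_eq).perm).map Prod.snd
  rwa [map_snd_columns, map_snd_twoLine] at this

theorem cycles_eq {w : List ℕ} {c : List (List ℕ × ℕ)} (h : IsCycleFactorisation w c) :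
    cycles w = c :=
  (existsUnique_isCycleFactorisation w).unique (isCycleFactorisation_cycles w) h

theorem cycles_injective : Function.Injective cycles := fun w w' h => by
  rw [← (isCycleFactorisation_cycles w).prod_eq, h, (isCycleFactorisation_cycles w').prod_eq]

theorem insertLeft_nil_iff {a : ℕ} {z : List ℕ} : InsertLeft a [] z ↔ z = [] :=
  ⟨fun h => by cases h; rfl, fun h => by subst h; exact .nil⟩

/-- Reading off the first letter of the result gives the two branches of a Pascal recursion. -/
theorem insertLeft_cons_iff {a b : ℕ} {x z : List ℕ} :
    InsertLeft a (b :: x) z ↔ (∃ x', z = b :: x' ∧ InsertLeft a x x') ∨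
      ∃ z', z = a :: z' ∧ InsertLeft a (b :: x) z' := by
  constructor
  · intro h
    cases h with
    | cons j b h =>
      cases j with
      | zero => exact Or.inl ⟨_, rfl, h⟩
      | succ j => exact Or.inr ⟨_, rfl, .cons j b h⟩
  · rintro (⟨x', rfl, h⟩ | ⟨z', rfl, h⟩)
    · exact .cons 0 b h
    · cases h with
      | cons j b h => exact .cons (j + 1) b h

/-- Nothing is inserted after the last letter, so the letter that closes a cycle survives. -/
theorem InsertLeft.getLast? {a : ℕ} {x x' : List ℕ} (h : InsertLeft a x x') :
    x'.getLast? = x.getLast? := by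
  induction h with
  | nil => rfl
  | cons j b h ih => simp [List.getLast?_append, List.getLast?_cons, ih]

theorem InsertLeft.perm_append_replicate {a : ℕ} {x x' : List ℕ} (h : InsertLeft a x x')
    (ha : a ∉ x) : x'.Perm (x ++ List.replicate (x'.count a) a) := by
  induction h with
  | nil => simp
  | @cons j b x x' h ih =>
    have hb : b ≠ a := fun e => ha (by simp [e])
    have ih := ih fun h => ha (List.mem_cons_of_mem _ h)
    rw [List.count_append, List.count_replicate_self, List.count_cons_of_ne hb,
      List.replicate_add]
    refine (List.perm_append_comm).trans ?_
    refine ((ih.cons b).append_right _).trans ?_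
    simp only [List.cons_append, List.append_assoc]
    exact ((List.perm_append_comm).append_left x).cons b

/-- Insertion of copies of `a` to the left of letters in the cycles of `c`. -/
abbrev InsertCycles (a : ℕ) : List (List ℕ × ℕ) → List (List ℕ × ℕ) → Prop :=
  List.Forall₂ fun p q => InsertLeft a (cycleWord p) (cycleWord q)

theorem insertLeft_flatMap {a : ℕ} {c d : List (List ℕ × ℕ)} (h : InsertCycles a c d) :
    InsertLeft a (c.flatMap cycleWord) (d.flatMap cycleWord) := by
  have append : ∀ {x x' y y' : List ℕ}, InsertLeft a x x' → InsertLeft a y y' →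
      InsertLeft a (x ++ y) (x' ++ y') := by
    intro x x' y y' h h'
    induction h with
    | nil => exact h'
    | cons j b _ ih => simpa using InsertLeft.cons j b ih
  induction h with
  | nil => exact .nil
  | cons h _ ih => simpa using append h ih

/-- Put the letter `b` in front of the first cycle. -/
def consHead (b : ℕ) : List (List ℕ × ℕ) → List (List ℕ × ℕ)
  | [] => []
  | (x, y) :: d => (b :: x, y) :: d

theorem consHead_injective (b : ℕ) : Function.Injective (consHead b) := by
  rintro (_ | ⟨⟨x, y⟩, d⟩) (_ | ⟨⟨x', y'⟩, d'⟩) h <;> simp_all [consHead]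

/-- The results of inserting `j` copies of `a` to the left of letters in the cycles of `c`. -/
def insertions (a : ℕ) (c : List (List ℕ × ℕ)) (j : ℕ) : Set (List (List ℕ × ℕ)) :=
  {d | InsertCycles a c d ∧ (d.flatMap cycleWord).count a = j}

theorem insertions_nil_zero (a : ℕ) : insertions a [] 0 = {[]} := by
  ext d
  simp only [insertions, InsertCycles, List.forall₂_nil_left_iff, Set.mem_ofPred_eq,
    Set.mem_singleton_iff]
  exact ⟨fun h => h.1, fun h => by simp [h]⟩

theorem insertions_nil_succ (a j : ℕ) : insertions a [] (j + 1) = ∅ := by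
  ext d
  simp only [insertions, InsertCycles, List.forall₂_nil_left_iff, Set.mem_ofPred_eq,
    Set.mem_empty_iff_false, iff_false]
  rintro ⟨rfl, h⟩
  simp at h

theorem insertCycles_cons_cons {a b : ℕ} {x : List ℕ} {y : ℕ} {c d : List (List ℕ × ℕ)} :
    InsertCycles a ((b :: x, y) :: c) d ↔
      (∃ d', d = consHead b d' ∧ InsertCycles a ((x, y) :: c) d') ∨
        ∃ d', d = consHead a d' ∧ InsertCycles a ((b :: x, y) :: c) d' := by
  constructor
  · intro h
    rcases h with _ | @⟨_, ⟨x', y'⟩, _, d', h, h'⟩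
    simp only [cycleWord, List.cons_append] at h
    rcases insertLeft_cons_iff.1 h with ⟨z, hz, hi⟩ | ⟨z, hz, hi⟩
    · cases x' with
      | nil =>
        simp at hz
        have := hi.getLast?
        simp [hz.2] at this
      | cons b' x' =>
        simp at hz
        obtain ⟨rfl, rfl⟩ := hz
        exact Or.inl ⟨(x', y') :: d', rfl, .cons hi h'⟩
    · cases x' with
      | nil =>
        simp at hz
        have := hi.getLast?
        simp [hz.2, List.getLast?_cons] at this
      | cons b' x' =>
        simp at hz
        obtain ⟨rfl, rfl⟩ := hz
        exact Or.inr ⟨(x', y') :: d', rfl, .cons hi h'⟩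
  · rintro (⟨d', rfl, h⟩ | ⟨d', rfl, h⟩)
    · rcases h with _ | @⟨_, ⟨x', y'⟩, _, d', h, h'⟩
      exact .cons (insertLeft_cons_iff.2 (Or.inl ⟨_, rfl, h⟩)) h'
    · rcases h with _ | @⟨_, ⟨x', y'⟩, _, d', h, h'⟩
      exact .cons (insertLeft_cons_iff.2 (Or.inr ⟨_, rfl, h⟩)) h'

theorem insertCycles_nil_cons {a y : ℕ} {c d : List (List ℕ × ℕ)} :
    InsertCycles a (([], y) :: c) d ↔
      (∃ d', d = ([], y) :: d' ∧ InsertCycles a c d') ∨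
        ∃ d', d = consHead a d' ∧ InsertCycles a (([], y) :: c) d' := by
  constructor
  · intro h
    rcases h with _ | @⟨_, ⟨x', y'⟩, _, d', h, h'⟩
    simp only [cycleWord, List.nil_append] at h
    rcases insertLeft_cons_iff.1 h with ⟨z, hz, hi⟩ | ⟨z, hz, hi⟩
    · rw [insertLeft_nil_iff] at hi
      subst hi
      cases x' with
      | nil =>
        simp at hz
        subst hz
        exact Or.inl ⟨d', rfl, h'⟩
      | cons b' x' => simp at hz
    · cases x' with
      | nil =>
        simp at hz
        have := hi.getLast?
        simp [hz.2] at this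
      | cons b' x' =>
        simp at hz
        obtain ⟨rfl, rfl⟩ := hz
        exact Or.inr ⟨(x', y') :: d', rfl, .cons hi h'⟩
  · rintro (⟨d', rfl, h⟩ | ⟨d', rfl, h⟩)
    · exact .cons (insertLeft_cons_iff.2 (Or.inl ⟨_, rfl, .nil⟩)) h
    · rcases h with _ | @⟨_, ⟨x', y'⟩, _, d', h, h'⟩
      exact .cons (insertLeft_cons_iff.2 (Or.inr ⟨_, rfl, h⟩)) h'

theorem count_consHead_self {a : ℕ} {c d : List (List ℕ × ℕ)} {p : List ℕ × ℕ}
    (h : InsertCycles a (p :: c) d) : ((consHead a d).flatMap cycleWord).count a =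
      (d.flatMap cycleWord).count a + 1 := by
  rcases h with _ | @⟨_, ⟨x', y'⟩, _, d', h, h'⟩
  simp [consHead, cycleWord]

theorem count_consHead_of_ne {a b : ℕ} (hb : b ≠ a) (d : List (List ℕ × ℕ)) :
    ((consHead b d).flatMap cycleWord).count a = (d.flatMap cycleWord).count a := by
  rcases d with _ | ⟨⟨x, y⟩, d⟩ <;> simp [consHead, cycleWord, hb]

/-- Pascal's rule for `multichoose`: `f` restores the first letter with no copy in front of it, `g`
puts one more copy at the very front. -/
theorem encard_eq_of_insert {D E : ℕ → Set (List (List ℕ × ℕ))} {f g : List (List ℕ × ℕ) →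
    List (List ℕ × ℕ)} {L : ℕ} (hf : f.Injective) (hg : g.Injective)
    (hE : ∀ j, (E j).encard = Nat.multichoose L j)
    (h0 : D 0 = f '' E 0) (hs : ∀ j, D (j + 1) = f '' E (j + 1) ∪ g '' D j)
    (hd : ∀ j, Disjoint (f '' E (j + 1)) (g '' D j)) (j : ℕ) :
    (D j).encard = Nat.multichoose (L + 1) j := by
  induction j with
  | zero => rw [h0, hf.encard_image, hE]; simp
  | succ j ih =>
    rw [hs, Set.encard_union_eq (hd j), hf.encard_image, hg.encard_image, hE, ih,
      Nat.multichoose_succ_succ]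
    simp

/-- Stars and bars: a result amounts to the number of copies in front of each letter. The induction
strips letters from the first cycle, then whole cycles. As `a` is a new letter, the two branches of
the recursion are disjoint. -/
theorem encard_insertions {a : ℕ} (c : List (List ℕ × ℕ)) (ha : a ∉ c.flatMap cycleWord)
    (j : ℕ) : (insertions a c j).encard =
      Nat.multichoose (c.flatMap cycleWord).length j := by
  induction c generalizing j with
  | nil =>
    cases j with
    | zero => simp [insertions_nil_zero]
    | succ j => simp [insertions_nil_succ]
  | cons p c ihc =>
    obtain ⟨x, y⟩ := p
    induction x generalizing j with
    | nil =>
      have hy : y ≠ a := by rintro rfl; simp [cycleWord] at ha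
      have hc : a ∉ c.flatMap cycleWord := by
        rw [List.flatMap_cons, List.mem_append, not_or] at ha
        exact ha.2
      have e : (List.flatMap cycleWord (([], y) :: c)).length =
        (c.flatMap cycleWord).length + 1 := by simp [cycleWord, Nat.add_comm]
      rw [e]
      refine encard_eq_of_insert (D := insertions a (([], y) :: c))
        (E := insertions a c) (f := fun d => ([], y) :: d)
        (g := consHead a) (fun d d' h => by simpa using h) (consHead_injective a)
        (ihc hc) ?_ ?_ ?_ j
      · ext d
        constructor
        · rintro ⟨h, hj⟩
          rcases insertCycles_nil_cons.1 h with ⟨d', rfl, h'⟩ | ⟨d', rfl, h'⟩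
          · exact ⟨d', ⟨h', by simpa [cycleWord, hy] using hj⟩, rfl⟩
          · rw [count_consHead_self h'] at hj
            omega
        · rintro ⟨d', ⟨h', hj⟩, rfl⟩
          exact ⟨insertCycles_nil_cons.2 (Or.inl ⟨d', rfl, h'⟩),
            by simpa [cycleWord, hy] using hj⟩
      · intro j
        ext d
        constructor
        · rintro ⟨h, hj⟩
          rcases insertCycles_nil_cons.1 h with ⟨d', rfl, h'⟩ | ⟨d', rfl, h'⟩
          · exact Or.inl ⟨d', ⟨h', by simpa [cycleWord, hy] using hj⟩, rfl⟩
          · rw [count_consHead_self h'] at hj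
            exact Or.inr ⟨d', ⟨h', by omega⟩, rfl⟩
        · rintro (⟨d', ⟨h', hj⟩, rfl⟩ | ⟨d', ⟨h', hj⟩, rfl⟩)
          · exact ⟨insertCycles_nil_cons.2 (Or.inl ⟨d', rfl, h'⟩),
              by simpa [cycleWord, hy] using hj⟩
          · exact ⟨insertCycles_nil_cons.2 (Or.inr ⟨d', rfl, h'⟩),
              by rw [count_consHead_self h', hj]⟩
      · intro j
        rw [Set.disjoint_left]
        rintro _ ⟨d, _, rfl⟩ ⟨d', _, h⟩
        rcases d' with _ | ⟨⟨x', y'⟩, d'⟩ <;> simp [consHead] at h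
    | cons b x ihx =>
      have hb : b ≠ a := by rintro rfl; simp [cycleWord] at ha
      have hx : a ∉ ((x, y) :: c).flatMap cycleWord := by
        rw [List.flatMap_cons, List.mem_append, not_or] at ha ⊢
        exact ⟨fun h => ha.1 (List.mem_cons_of_mem _ h), ha.2⟩
      have e : (List.flatMap cycleWord ((b :: x, y) :: c)).length =
        (((x, y) :: c).flatMap cycleWord).length + 1 := by simp [cycleWord, Nat.add_comm]
      rw [e]
      refine encard_eq_of_insert (D := insertions a ((b :: x, y) :: c))
        (E := insertions a ((x, y) :: c)) (f := consHead b)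
        (g := consHead a) (consHead_injective b) (consHead_injective a)
        (fun j => ihx j hx) ?_ ?_ ?_ j
      · ext d
        constructor
        · rintro ⟨h, hj⟩
          rcases insertCycles_cons_cons.1 h with ⟨d', rfl, h'⟩ | ⟨d', rfl, h'⟩
          · exact ⟨d', ⟨h', by rwa [count_consHead_of_ne hb] at hj⟩, rfl⟩
          · rw [count_consHead_self h'] at hj
            omega
        · rintro ⟨d', ⟨h', hj⟩, rfl⟩
          exact ⟨insertCycles_cons_cons.2 (Or.inl ⟨d', rfl, h'⟩),
            by rwa [count_consHead_of_ne hb]⟩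
      · intro j
        ext d
        constructor
        · rintro ⟨h, hj⟩
          rcases insertCycles_cons_cons.1 h with ⟨d', rfl, h'⟩ | ⟨d', rfl, h'⟩
          · exact Or.inl ⟨d', ⟨h', by rwa [count_consHead_of_ne hb] at hj⟩, rfl⟩
          · rw [count_consHead_self h'] at hj
            exact Or.inr ⟨d', ⟨h', by omega⟩, rfl⟩
        · rintro (⟨d', ⟨h', hj⟩, rfl⟩ | ⟨d', ⟨h', hj⟩, rfl⟩)
          · exact ⟨insertCycles_cons_cons.2 (Or.inl ⟨d', rfl, h'⟩),
              by rwa [count_consHead_of_ne hb]⟩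
          · exact ⟨insertCycles_cons_cons.2 (Or.inr ⟨d', rfl, h'⟩),
              by rw [count_consHead_self h', hj]⟩
      · intro j
        rw [Set.disjoint_left]
        rintro _ ⟨d, _, rfl⟩ ⟨d', hd', h⟩
        have := hd'.1
        rcases this with _ | @⟨_, ⟨x', y'⟩, _, d', _, _⟩
        rcases d with _ | ⟨⟨x'', y''⟩, d⟩ <;> simp [consHead] at h
        exact hb h.1.1.1.symm

theorem InsertCycles.length_eq {a : ℕ} {c d : List (List ℕ × ℕ)} (h : InsertCycles a c d) :
    d.length = c.length := (List.Forall₂.length_eq h).symm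

theorem IsExtension.length_eq {t m k : ℕ} {c c' : List (List ℕ × ℕ)}
    (h : IsExtension t m k c c') : c'.length = c.length + k := by
  obtain ⟨d, hd, rfl, -⟩ := h
  simp [InsertCycles.length_eq hd]

theorem flatMap_cycleWord_replicate (t k : ℕ) :
    List.flatMap cycleWord (List.replicate k ([], t)) = List.replicate k t := by
  induction k with
  | zero => rfl
  | succ k ih => simp [List.replicate_succ, ih, cycleWord]

/-- The closing letters do not change, the inserted `t` exceeds them all, and the singletons `t`
come last in the order. So the list is the factorisation of its own product. -/
theorem InsertCycles.isCycleFactorisation {t k : ℕ} {w : List ℕ} {d : List (List ℕ × ℕ)}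
    (hw : ∀ x ∈ w, x < t) (hd : InsertCycles t (cycles w) d) :
    IsCycleFactorisation (cycleProd (d ++ List.replicate k ([], t)))
      (d ++ List.replicate k ([], t)) := by
  have hc := isCycleFactorisation_cycles w
  have hlast : d.map Prod.snd = (cycles w).map Prod.snd := by
    generalize cycles w = c at hd
    induction hd with
    | nil => rfl
    | @cons p q c d h _ ih =>
      have := h.getLast?
      simp [cycleWord] at this
      simp [this, ih]
  have hmem : ∀ y ∈ (cycles w).map Prod.snd, y < t := by
    intro y hy
    obtain ⟨p, hp, rfl⟩ := List.mem_map.1 hy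
    refine hw _ (hc.perm.mem_iff.1 ?_)
    simp only [List.mem_flatMap]
    exact ⟨p, hp, by simp [cycleWord]⟩
  refine ⟨rfl, ?_, ?_⟩
  · rw [List.map_append, hlast, List.pairwise_append]
    refine ⟨hc.sorted, ?_, ?_⟩
    · simp [List.pairwise_replicate]
    · intro y hy z hz
      simp at hz
      rw [hz.2]
      exact (hmem y hy).le
  · have key : ∀ p ∈ d, ∀ x ∈ p.1, p.2 < x := by
      have hlt := hc.lt
      have hall : ∀ x ∈ (cycles w).flatMap cycleWord, x < t :=
        fun x hx => hw x (hc.perm.mem_iff.1 hx)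
      generalize cycles w = c at hd hlt hmem hall
      clear hlast hc
      induction hd with
      | nil => simp
      | @cons p q c d h _ ih =>
        have hl := h.getLast?
        simp [cycleWord] at hl
        have hm : p.2 < t := hmem p.2 (by simp)
        have hp : t ∉ cycleWord p := by
          intro h1
          exact lt_irrefl _ (hall t (by simp [h1]))
        have hperm := h.perm_append_replicate hp
        -- Cancelling the common last letter leaves all copies of `t` among the letters before it.
        have hperm' : q.1.Perm (p.1 ++ List.replicate ((cycleWord q).count t) t) := by
          have e : ∀ (l : List ℕ) (y : ℕ), (l ++ [y]).Perm (y :: l) := fun l y =>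
            List.perm_append_comm (l₁ := l) (l₂ := [y])
          refine List.Perm.cons_inv (a := p.2) ?_
          rw [← List.cons_append]
          refine List.Perm.trans ?_ (hperm.trans ((e p.1 p.2).append_right _))
          rw [← hl]
          exact (e q.1 q.2).symm
        intro r hr x hx
        rcases List.mem_cons.1 hr with rfl | hr
        · rw [hl]
          rcases List.mem_append.1 (hperm'.mem_iff.1 hx) with h1 | h1
          · exact hlt p (by simp) x h1
          · rwa [(List.mem_replicate.1 h1).2]
        · refine ih (fun p hp => hlt p (List.mem_cons_of_mem _ hp))
            (fun y hy => hmem y (by rw [List.map_cons]; exact List.mem_cons_of_mem _ hy))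
            (fun y hy => hall y ?_) r hr x hx
          rw [List.flatMap_cons]
          exact List.mem_append_right _ hy
    intro p hp x hx
    rcases List.mem_append.1 hp with hp | hp
    · exact key p hp x hx
    · simp at hp
      simp [hp.2] at hx
-- Extensions of a multiset permutation
instance (n : ℕ → ℕ) (t : ℕ) : Finite (MultisetPerm n t) := by
  classical
  refine Set.Finite.to_subtype (s := {w : List ℕ | (w : Multiset ℕ) =
    ∑ i ∈ Finset.Icc 1 t, Multiset.replicate (n i) i}) ?_
  refine (Multiset.lists (∑ i ∈ Finset.Icc 1 t, Multiset.replicate (n i) i)).finite_toSet.subset ?_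
  intro w hw
  simpa [Multiset.mem_lists_iff] using Eq.symm hw

theorem MultisetPerm.length_eq {n : ℕ → ℕ} {t : ℕ} (w : MultisetPerm n t) :
    w.1.length = total n t := by
  rw [← Multiset.coe_card, w.2]
  simp [total]

theorem MultisetPerm.lt_succ {n : ℕ → ℕ} {t : ℕ} (w : MultisetPerm n t) :
    ∀ x ∈ w.1, x < t + 1 := by
  intro x hx
  rw [← Multiset.mem_coe, w.2, Multiset.mem_sum] at hx
  obtain ⟨i, hi, h⟩ := hx
  rw [Multiset.eq_of_mem_replicate h]
  have := (Finset.mem_Icc.1 hi).2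
  omega

/-- Words are counted through the injective map to their cycles, and removing the `k` final
singletons leaves an insertion. The count depends on `w` only through its length, which is why the
increments of `K_t` do not depend on the past. -/
theorem encard_extensions {n : ℕ → ℕ} {t k : ℕ} (w : MultisetPerm n t) (hk : k ≤ n (t + 1)) :
    {w' : MultisetPerm n (t + 1) |
      IsExtension (t + 1) (n (t + 1)) k (cycles w.1) (cycles w'.1)}.encard =
      Nat.multichoose (total n t) (n (t + 1) - k) := by
  have hperm := (isCycleFactorisation_cycles w.1).perm
  have hnot : t + 1 ∉ (cycles w.1).flatMap cycleWord := fun h =>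
    lt_irrefl _ (w.lt_succ _ (hperm.mem_iff.1 h))
  have hinj : Function.Injective fun w' : MultisetPerm n (t + 1) => cycles w'.1 :=
    cycles_injective.comp Subtype.val_injective
  have himg : (fun w' : MultisetPerm n (t + 1) => cycles w'.1) ''
      {w' | IsExtension (t + 1) (n (t + 1)) k (cycles w.1) (cycles w'.1)} =
      (· ++ List.replicate k ([], t + 1)) '' insertions (t + 1) (cycles w.1)
        (n (t + 1) - k) := by
    ext c
    constructor
    · rintro ⟨w', ⟨d, hd, he, hc⟩, rfl⟩
      refine ⟨d, ⟨hd, ?_⟩, he.symm⟩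
      rw [he, List.flatMap_append, flatMap_cycleWord_replicate, List.count_append,
        List.count_replicate_self] at hc
      omega
    · rintro ⟨d, ⟨hd, hc⟩, rfl⟩
      have hfac := hd.isCycleFactorisation (k := k) w.lt_succ
      have hp := hfac.perm
      rw [List.flatMap_append, flatMap_cycleWord_replicate] at hp
      have hd' := (insertLeft_flatMap hd).perm_append_replicate hnot
      refine ⟨⟨cycleProd (d ++ List.replicate k ([], t + 1)), ?_⟩, ⟨d, hd, ?_, ?_⟩, ?_⟩
      · have h1 : (cycleProd (d ++ List.replicate k ([], t + 1))).Perm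
            (w.1 ++ List.replicate (n (t + 1)) (t + 1)) := by
          refine hp.symm.trans ((hd'.append_right _).trans ?_)
          rw [List.append_assoc, ← List.replicate_add, hc, Nat.sub_add_cancel hk]
          exact hperm.append_right _
        rw [Multiset.coe_eq_coe.2 h1, Finset.sum_Icc_succ_top (by omega),
          ← Multiset.coe_add]
        exact congrArg (· + Multiset.replicate (n (t + 1)) (t + 1)) w.2
      · exact cycles_eq hfac
      · simp only [cycles_eq hfac]
        rw [List.flatMap_append, flatMap_cycleWord_replicate, List.count_append,
          List.count_replicate_self, hc, Nat.sub_add_cancel hk]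
      · exact cycles_eq hfac
  rw [← hinj.encard_image, himg, Function.Injective.encard_image (List.append_left_injective _),
    encard_insertions _ hnot, hperm.length_eq, w.length_eq]

theorem numCycles_of_isExtension {t m k : ℕ} {w w' : List ℕ}
    (h : IsExtension t m k (cycles w) (cycles w')) : numCycles w' = numCycles w + k :=
  h.length_eq

/-- The probability that step `t` of the process forms exactly `k` new cycles. -/
noncomputable def stepProb (n : ℕ → ℕ) (θ : ℝ) (t k : ℕ) : ℝ :=
  (Nat.multichoose (total n (t - 1)) (n t - k) : ℝ) * (θ ^ k / weight n θ t)

/-- The conditional expectation of a function of the next cycle count depends on `w` only through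
its own cycle count. Values in a module cover real moments and complex exponentials at once. -/
theorem sum_transProb_smul {E : Type*} [AddCommGroup E] [Module ℝ E] {n : ℕ → ℕ} (θ : ℝ)
    {t : ℕ} (w : MultisetPerm n t) [Fintype (MultisetPerm n (t + 1))] (f : ℕ → E) :
    ∑ w' : MultisetPerm n (t + 1), transProb n θ (t + 1) w.1 w'.1 • f (numCycles w'.1) =
      ∑ k ∈ Finset.range (n (t + 1) + 1), stepProb n θ (t + 1) k • f (numCycles w.1 + k) := by
  classical
  simp only [transProb, Finset.sum_smul]
  rw [Finset.sum_comm]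
  refine Finset.sum_congr rfl fun k hk => ?_
  have hcard := encard_extensions w (Nat.lt_succ_iff.1 (Finset.mem_range.1 hk))
  have h1 : ∀ w' : MultisetPerm n (t + 1),
      (if IsExtension (t + 1) (n (t + 1)) k (cycles w.1) (cycles w'.1) then
        θ ^ k / weight n θ (t + 1) else 0) • f (numCycles w'.1) =
      if IsExtension (t + 1) (n (t + 1)) k (cycles w.1) (cycles w'.1) then
        (θ ^ k / weight n θ (t + 1)) • f (numCycles w.1 + k) else 0 := by
    intro w'
    split_ifs with h
    · rw [numCycles_of_isExtension h]
    · simp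
  simp only [h1]
  rw [← Finset.sum_filter, Finset.sum_const, ← Nat.cast_smul_eq_nsmul ℝ, smul_smul, stepProb]
  congr 3
  rw [← Finset.coe_filter_univ, Set.encard_coe_eq_coe_finsetCard] at hcard
  have hcard : _ = Nat.multichoose _ _ := ENat.natCast_inj.1 hcard
  simpa using hcard

/-! ### One-step laws of the chain -/

section MarkovChain

variable {Ω : Type*} [MeasurableSpace Ω] {P : Measure Ω} {n : ℕ → ℕ}
  {θ : ℝ} {π : (t : ℕ) → Ω → MultisetPerm n t}

namespace IsMultisetCRP

theorem measurableSet_forall (hπ : IsMultisetCRP P n θ π) (j t : ℕ)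
    (w : (s : ℕ) → MultisetPerm n s) :
    MeasurableSet {ω | ∀ s, j ≤ s → s ≤ t → π s ω = w s} := by
  simp only [Set.ofPred_forall]
  exact .iInter fun s => .iInter fun _ => .iInter fun _ => hπ.measurableSet_eq s (w s)

end IsMultisetCRP

variable [IsProbabilityMeasure P]

theorem integral_eq_sum_fibres {E : Type*} [NormedAddCommGroup E] [NormedSpace ℝ E]
    [CompleteSpace E] {ι : Type*} [Fintype ι] {X : Ω → ι} (hX : ∀ x, MeasurableSet {ω | X ω = x})
    (g : ι → E) : ∫ ω, g (X ω) ∂P = ∑ x, P.real {ω | X ω = x} • g x := by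
  let _ : MeasurableSpace ι := ⊤
  have hX' : Measurable X := measurable_to_countable' hX
  rw [← integral_map (f := g) hX'.aemeasurable (by fun_prop)]
  have := Measure.isProbabilityMeasure_map (μ := P) hX'.aemeasurable
  rw [integral_fintype (.of_finite)]
  refine Finset.sum_congr rfl fun x _ => ?_
  rw [map_measureReal_apply hX' (by trivial)]
  rfl

namespace IsMultisetCRP

/-- Total probability over the state at time `j`, which forgets one early coordinate of the path. -/
theorem measureReal_forall_succ (hπ : IsMultisetCRP P n θ π) {j t : ℕ} (hj : j ≤ t)
    (w : (s : ℕ) → MultisetPerm n s) :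
    P.real {ω | ∀ s, j + 1 ≤ s → s ≤ t → π s ω = w s} =
      ∑ᶠ x : MultisetPerm n j,
        P.real {ω | ∀ s, j ≤ s → s ≤ t → π s ω = Function.update w j x s} := by
  have := Fintype.ofFinite (MultisetPerm n j)
  rw [finsum_eq_sum_of_fintype]
  rw [← measureReal_iUnion_fintype]
  · congr 1
    ext ω
    simp only [Set.mem_ofPred_eq, Set.mem_iUnion]
    constructor
    · intro h
      refine ⟨π j ω, fun s hs hst => ?_⟩
      rcases eq_or_lt_of_le hs with rfl | hs
      · simp
      · rw [Function.update_of_ne hs.ne', h s hs hst]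
    · rintro ⟨x, h⟩ s hs hst
      rw [h s (by omega) hst, Function.update_of_ne (by omega)]
  · intro x y hxy
    rw [Function.onFun, Set.disjoint_left]
    intro ω hx hy
    have h1 := hx j le_rfl hj
    have h2 := hy j le_rfl hj
    rw [Function.update_self] at h1 h2
    exact hxy (h1.symm.trans h2)
  · exact fun x => hπ.measurableSet_forall j t _

/-- The law is prescribed only for paths that start at time 0. Summing out the early coordinates one
by one keeps the last transition factor. -/
theorem measureReal_forall_eq_mul (hπ : IsMultisetCRP P n θ π) {j t : ℕ} (hj : j ≤ t)
    (w : (s : ℕ) → MultisetPerm n s) :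
    P.real {ω | ∀ s, j ≤ s → s ≤ t + 1 → π s ω = w s} =
      P.real {ω | ∀ s, j ≤ s → s ≤ t → π s ω = w s} *
        transProb n θ (t + 1) (w t).1 (w (t + 1)).1 := by
  induction j generalizing w with
  | zero =>
    have h1 := hπ.law (t + 1) w
    rw [Finset.prod_range_succ, ← hπ.law t w] at h1
    simpa using h1
  | succ j ih =>
    have := Fintype.ofFinite (MultisetPerm n j)
    rw [hπ.measureReal_forall_succ (by omega), hπ.measureReal_forall_succ (by omega),
      finsum_eq_sum_of_fintype, finsum_eq_sum_of_fintype, Finset.sum_mul]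
    refine Finset.sum_congr rfl fun x _ => ?_
    rw [ih (by omega), Function.update_of_ne (by omega), Function.update_of_ne (by omega)]

theorem measureReal_pair (hπ : IsMultisetCRP P n θ π) {t : ℕ} (u : MultisetPerm n t)
    (v : MultisetPerm n (t + 1)) :
    P.real {ω | π t ω = u ∧ π (t + 1) ω = v} =
      P.real {ω | π t ω = u} * transProb n θ (t + 1) u.1 v.1 := by
  have : Nonempty Ω := P.nonempty_of_neZero
  -- Only the coordinates `t` and `t + 1` of `w` matter; a sample path supplies some value for the
  -- others.
  let ω₀ : Ω := Classical.arbitrary Ω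
  let w : (s : ℕ) → MultisetPerm n s :=
    Function.update (Function.update (fun s => π s ω₀) t u) (t + 1) v
  have hu : w t = u := by simp [w]
  have hv : w (t + 1) = v := by simp [w]
  have h := hπ.measureReal_forall_eq_mul (le_refl t) w
  rw [hu, hv] at h
  convert h using 3
  · ext ω
    constructor
    · rintro ⟨h1, h2⟩ s hs hs'
      obtain rfl | rfl : s = t ∨ s = t + 1 := by omega
      · rw [h1, hu]
      · rw [h2, hv]
    · intro h
      exact ⟨(h t le_rfl (by omega)).trans hu, (h (t + 1) (by omega) le_rfl).trans hv⟩
  · ext ω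
    constructor
    · rintro h1 s hs hs'
      obtain rfl : s = t := by omega
      exact h1.trans hu.symm
    · intro h
      exact (h t le_rfl le_rfl).trans hu

/-- Independence of the increment from the past, in the form of test functions. Mean, variance and
characteristic function come from three choices of `f`. -/
theorem integral_numCycles_succ (hπ : IsMultisetCRP P n θ π) {E : Type*}
    [NormedAddCommGroup E] [NormedSpace ℝ E] [CompleteSpace E] (t : ℕ) (f : ℕ → E) :
    ∫ ω, f (numCycles (π (t + 1) ω).1) ∂P = ∑ k ∈ Finset.range (n (t + 1) + 1),
      stepProb n θ (t + 1) k • ∫ ω, f (numCycles (π t ω).1 + k) ∂P := by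
  have := Fintype.ofFinite (MultisetPerm n t)
  have := Fintype.ofFinite (MultisetPerm n (t + 1))
  have h1 := integral_eq_sum_fibres (P := P) (X := fun ω => (π t ω, π (t + 1) ω))
    (fun x => by
      simp only [Prod.ext_iff]
      exact (hπ.measurableSet_eq t x.1).inter (hπ.measurableSet_eq (t + 1) x.2))
    (fun x => f (numCycles x.2.1))
  rw [h1, Fintype.sum_prod_type]
  have h2 : ∀ k, ∫ ω, f (numCycles (π t ω).1 + k) ∂P =
      ∑ x, P.real {ω | π t ω = x} • f (numCycles x.1 + k) := fun k =>
    integral_eq_sum_fibres (P := P) (X := π t) (hπ.measurableSet_eq t)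
      (fun x => f (numCycles x.1 + k))
  simp only [h2, Finset.smul_sum]
  conv_rhs => rw [Finset.sum_comm]
  refine Finset.sum_congr rfl fun u _ => ?_
  have h3 := congrArg (fun z : E => P.real {ω | π t ω = u} • z) (sum_transProb_smul θ u f)
  simp only [Finset.smul_sum] at h3
  simp only [Prod.mk.injEq, hπ.measureReal_pair, mul_smul]
  rw [h3]
  exact Finset.sum_congr rfl fun k _ => smul_comm _ _ _

/-- A transition that lowers the cycle count is not an extension, so it has probability zero, and
there are finitely many pairs of states. -/
theorem ae_numCycles_le_succ (hπ : IsMultisetCRP P n θ π) (t : ℕ) :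
    ∀ᵐ ω ∂P, numCycles (π t ω).1 ≤ numCycles (π (t + 1) ω).1 := by
  have h : ∀ᵐ ω ∂P, ∀ (u : MultisetPerm n t) (v : MultisetPerm n (t + 1)),
      numCycles v.1 < numCycles u.1 → ¬ (π t ω = u ∧ π (t + 1) ω = v) := by
    rw [ae_all_iff]
    intro u
    rw [ae_all_iff]
    intro v
    by_cases huv : numCycles v.1 < numCycles u.1
    · have h0 : transProb n θ (t + 1) u.1 v.1 = 0 := by
        refine Finset.sum_eq_zero fun k _ => if_neg fun he => ?_
        have := numCycles_of_isExtension he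
        omega
      have h1 := hπ.measureReal_pair u v
      rw [h0, mul_zero, measureReal_eq_zero_iff] at h1
      simp only [huv, forall_const]
      rw [ae_iff]
      simpa using h1
    · simp [huv]
  filter_upwards [h] with ω hω
  by_contra hlt
  exact hω _ _ (not_le.1 hlt) ⟨rfl, rfl⟩

theorem numCycles_zero (w : MultisetPerm n 0) : numCycles w.1 = 0 := by
  have h := (isCycleFactorisation_cycles w.1).perm.length_eq
  rw [w.length_eq] at h
  rw [numCycles, List.length_eq_zero_iff]
  cases hc : cycles w.1 with
  | nil => rfl
  | cons p c => simp [hc, total, cycleWord] at h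

end IsMultisetCRP

end MarkovChain

/-! ### Moments of the Bose–Einstein law -/

theorem mul_multichoose_succ (M r : ℕ) :
    M * Nat.multichoose (M + 1) r = (r + 1) * Nat.multichoose M (r + 1) := by
  rw [Nat.multichoose_eq, Nat.multichoose_eq]
  cases M with
  | zero => simp
  | succ M =>
    have h := Nat.choose_succ_right_eq (M + 1 + r) r
    rw [Nat.add_sub_cancel] at h
    rw [show M + 1 + 1 + r - 1 = M + 1 + r by omega,
      show M + 1 + (r + 1) - 1 = M + 1 + r by omega]
    linarith

/-- The binomial moment `∑ k, binom(k, j) multichoose(N, m - k)`. -/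
def binomMoment (N j m : ℕ) : ℕ :=
  ∑ k ∈ Finset.range (m + 1), k.choose j * Nat.multichoose N (m - k)

theorem binomMoment_zero (N m : ℕ) : binomMoment N 0 m = Nat.multichoose (N + 1) m := by
  induction m with
  | zero => simp [binomMoment]
  | succ m ih =>
    rw [binomMoment, Finset.sum_range_succ', Nat.multichoose_succ_succ, ← ih, add_comm]
    simp [binomMoment]

theorem binomMoment_succ_succ (N j m : ℕ) :
    binomMoment N (j + 1) (m + 1) = binomMoment N j m + binomMoment N (j + 1) m := by
  rw [binomMoment, Finset.sum_range_succ']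
  simp [binomMoment, Nat.choose_succ_succ, add_mul, Finset.sum_add_distrib]

theorem binomMoment_of_lt {N j m : ℕ} (h : m < j) : binomMoment N j m = 0 := by
  refine Finset.sum_eq_zero fun k hk => ?_
  rw [Nat.choose_eq_zero_of_lt, zero_mul]
  have := Finset.mem_range.1 hk
  omega

/-- In generating functions, x^j/(1-x)^(j+1) times (1-x)^(-N) is x^j (1-x)^(-(N+j+1)). -/
theorem binomMoment_add (N j r : ℕ) :
    binomMoment N j (j + r) = Nat.multichoose (N + j + 1) r := by
  induction j generalizing r with
  | zero => simp [binomMoment_zero]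
  | succ j ih =>
    induction r with
    | zero =>
      rw [add_zero, binomMoment_succ_succ, binomMoment_of_lt (Nat.lt_succ_self j)]
      have := ih 0
      simp at this
      simp [this]
    | succ r ihr =>
      rw [show j + 1 + (r + 1) = (j + 1 + r) + 1 by omega, binomMoment_succ_succ, ihr,
        show j + 1 + r = j + (r + 1) by omega, ih,
        show N + (j + 1) + 1 = (N + j + 1) + 1 by omega, Nat.multichoose_succ_succ (N + j + 1) r]

/-- The ratio of consecutive binomial moments; it yields every factorial moment from the total mass.
-/
theorem mul_binomMoment_succ (N j m : ℕ) :
    ((N : ℝ) + j + 1) * binomMoment N (j + 1) m = (m - j) * binomMoment N j m := by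
  rcases lt_trichotomy m j with h | rfl | h
  · rw [binomMoment_of_lt h, binomMoment_of_lt (by omega)]; simp
  · rw [binomMoment_of_lt (Nat.lt_succ_self m)]; simp
  · obtain ⟨r, rfl⟩ := Nat.exists_eq_add_of_lt h
    rw [show j + r + 1 = j + (r + 1) by omega, binomMoment_add,
      show j + (r + 1) = (j + 1) + r by omega, binomMoment_add]
    have := mul_multichoose_succ (N + j + 1) r
    have h' : (((N + j + 1) * Nat.multichoose (N + j + 1 + 1) r : ℕ) : ℝ) =
      ((r + 1) * Nat.multichoose (N + j + 1) (r + 1) : ℕ) := by rw [this]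
    push_cast at h' ⊢
    rw [show N + (j + 1) + 1 = N + j + 1 + 1 by omega, h']
    ring

/-- The probability of `k` balls in a given box, for `m` balls in `N + 1` boxes and
Bose–Einstein statistics. -/
noncomputable def boseEinstein (N m k : ℕ) : ℝ :=
  (Nat.multichoose N (m - k) : ℝ) / Nat.multichoose (N + 1) m

theorem boseEinstein_nonneg (N m k : ℕ) : 0 ≤ boseEinstein N m k := by
  unfold boseEinstein; positivity

theorem multichoose_succ_pos (N m : ℕ) : 0 < Nat.multichoose (N + 1) m := by
  rw [Nat.multichoose_eq]
  exact Nat.choose_pos (by omega)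

/-- For θ = 1 all placements are equally likely, and the new cycles act as one box besides the
letters present. -/
theorem stepProb_one (n : ℕ → ℕ) (t k : ℕ) :
    stepProb n 1 t k = boseEinstein (total n (t - 1)) (n t) k := by
  have : weight n 1 t = Nat.multichoose (total n (t - 1) + 1) (n t) := by
    rw [← binomMoment_zero, weight, binomMoment]
    simp
  rw [stepProb, this, boseEinstein]
  simp [div_eq_mul_inv]

theorem sum_choose_mul_boseEinstein (N m j : ℕ) :
    ∑ k ∈ Finset.range (m + 1), (k.choose j : ℝ) * boseEinstein N m k =
      binomMoment N j m / Nat.multichoose (N + 1) m := by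
  simp only [binomMoment, boseEinstein]
  push_cast
  rw [Finset.sum_div]
  exact Finset.sum_congr rfl fun k _ => by ring

theorem sum_boseEinstein (N m : ℕ) :
    ∑ k ∈ Finset.range (m + 1), boseEinstein N m k = 1 := by
  have h := sum_choose_mul_boseEinstein N m 0
  have : (0 : ℝ) < Nat.multichoose (N + 1) m := by exact_mod_cast multichoose_succ_pos N m
  rw [binomMoment_zero, div_self this.ne'] at h
  simpa using h

theorem sum_choose_succ_mul_boseEinstein (N m j : ℕ) :
    ∑ k ∈ Finset.range (m + 1), (k.choose (j + 1) : ℝ) * boseEinstein N m k =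
      (m - j) / (N + j + 1) *
        ∑ k ∈ Finset.range (m + 1), (k.choose j : ℝ) * boseEinstein N m k := by
  rw [sum_choose_mul_boseEinstein, sum_choose_mul_boseEinstein]
  have h1 : (0 : ℝ) < N + j + 1 := by positivity
  have : (0 : ℝ) < Nat.multichoose (N + 1) m := by exact_mod_cast multichoose_succ_pos N m
  have h2 := mul_binomMoment_succ N j m
  field_simp
  linarith

theorem sum_id_mul_boseEinstein (N m : ℕ) :
    ∑ k ∈ Finset.range (m + 1), (k : ℝ) * boseEinstein N m k = m / (N + 1) := by
  have h := sum_choose_succ_mul_boseEinstein N m 0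
  simpa [sum_boseEinstein] using h

theorem sum_choose_two_mul_boseEinstein (N m : ℕ) :
    ∑ k ∈ Finset.range (m + 1), (k.choose 2 : ℝ) * boseEinstein N m k =
      (m - 1) / (N + 2) * (m / (N + 1)) := by
  have h := sum_choose_succ_mul_boseEinstein N m 1
  simp only [Nat.choose_one_right, sum_id_mul_boseEinstein] at h
  rw [h]
  push_cast
  ring

theorem sum_choose_three_mul_boseEinstein (N m : ℕ) :
    ∑ k ∈ Finset.range (m + 1), (k.choose 3 : ℝ) * boseEinstein N m k =
      (m - 2) / (N + 3) * ((m - 1) / (N + 2) * (m / (N + 1))) := by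
  have h := sum_choose_succ_mul_boseEinstein N m 2
  rw [sum_choose_two_mul_boseEinstein] at h
  rw [h]
  push_cast
  ring

theorem sq_eq_choose (k : ℕ) : k ^ 2 = 2 * k.choose 2 + k := by
  induction k with
  | zero => simp
  | succ k ih =>
    have : (k + 1).choose 2 = k + k.choose 2 := by
      rw [Nat.choose_succ_succ' k 1, Nat.choose_one_right]
    rw [this]
    linarith

theorem cube_eq_choose (k : ℕ) : k ^ 3 = 6 * k.choose 3 + 6 * k.choose 2 + k := by
  induction k with
  | zero => simp
  | succ k ih =>
    have h2 : (k + 1).choose 2 = k + k.choose 2 := by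
      rw [Nat.choose_succ_succ' k 1, Nat.choose_one_right]
    have h3 : (k + 1).choose 3 = k.choose 2 + k.choose 3 := Nat.choose_succ_succ' k 2
    have := sq_eq_choose k
    rw [h2, h3]
    linarith

theorem sum_sq_sub_mul_boseEinstein (N m : ℕ) :
    ∑ k ∈ Finset.range (m + 1), ((k : ℝ) - m / (N + 1)) ^ 2 * boseEinstein N m k =
      (m : ℝ) * N * (N + 1 + m) / ((N + 1) ^ 2 * (N + 2)) := by
  have h : ∀ k : ℕ, ((k : ℝ) - m / (N + 1)) ^ 2 * boseEinstein N m k =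
      2 * ((k.choose 2 : ℝ) * boseEinstein N m k) + (1 - 2 * ((m : ℝ) / (N + 1))) *
        ((k : ℝ) * boseEinstein N m k) + ((m : ℝ) / (N + 1)) ^ 2 * boseEinstein N m k := by
    intro k
    have : (k : ℝ) ^ 2 = 2 * k.choose 2 + k := by exact_mod_cast sq_eq_choose k
    linear_combination (boseEinstein N m k) * this
  simp only [h, Finset.sum_add_distrib, ← Finset.mul_sum]
  rw [sum_boseEinstein, sum_id_mul_boseEinstein, sum_choose_two_mul_boseEinstein]
  field_simp
  ring

/-- Without other boxes all `m` balls fall into the given one, as in the first step of the process.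
-/
theorem boseEinstein_zero_of_lt {m k : ℕ} (h : k < m) : boseEinstein 0 m k = 0 := by
  obtain ⟨r, rfl⟩ := Nat.exists_eq_add_of_lt h
  rw [boseEinstein, show k + r + 1 - k = r + 1 by omega]
  simp

theorem sum_abs_cube_mul_boseEinstein_zero (m : ℕ) :
    ∑ k ∈ Finset.range (m + 1), |(k : ℝ) - m| ^ 3 * boseEinstein 0 m k = 0 := by
  refine Finset.sum_eq_zero fun k hk => ?_
  rcases (Nat.lt_succ_iff.1 (Finset.mem_range.1 hk)).lt_or_eq with h | rfl
  · rw [boseEinstein_zero_of_lt h, mul_zero]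
  · simp

/-- Here |k - e|³ ≤ k³ + e³, and k³ expands in binomial coefficients, whose moments are controlled
by powers of e. The 7 is 6 from that expansion plus 1 from e³. -/
theorem sum_abs_cube_mul_boseEinstein_le {N m : ℕ} (hm : 1 ≤ m) :
    ∑ k ∈ Finset.range (m + 1), |(k : ℝ) - m / (N + 1)| ^ 3 * boseEinstein N m k ≤
      7 * ((m : ℝ) / (N + 1)) ^ 3 + 6 * ((m : ℝ) / (N + 1)) ^ 2 + (m : ℝ) / (N + 1) := by
  set e : ℝ := (m : ℝ) / (N + 1) with he
  have he0 : 0 ≤ e := by positivity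
  have hle : ∀ k ∈ Finset.range (m + 1), |(k : ℝ) - e| ^ 3 * boseEinstein N m k ≤
      6 * (k.choose 3 * boseEinstein N m k) + 6 * (k.choose 2 * boseEinstein N m k) +
        k * boseEinstein N m k + e ^ 3 * boseEinstein N m k := by
    intro k _
    have hk : (k : ℝ) ^ 3 = 6 * k.choose 3 + 6 * k.choose 2 + k := by
      exact_mod_cast cube_eq_choose k
    have hk0 : (0 : ℝ) ≤ k := by positivity
    have : |(k : ℝ) - e| ^ 3 ≤ k ^ 3 + e ^ 3 := by
      rcases abs_cases ((k : ℝ) - e) with ⟨h, h'⟩ | ⟨h, h'⟩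
      · rw [h]
        have : ((k : ℝ) - e) ^ 3 ≤ (k : ℝ) ^ 3 := pow_le_pow_left₀ h' (by linarith) 3
        have := pow_nonneg he0 3
        linarith
      · rw [h]
        have : (-((k : ℝ) - e)) ^ 3 ≤ e ^ 3 := pow_le_pow_left₀ (by linarith) (by linarith) 3
        have := pow_nonneg hk0 3
        linarith
    calc _ ≤ (k ^ 3 + e ^ 3) * boseEinstein N m k :=
          mul_le_mul_of_nonneg_right this (boseEinstein_nonneg N m k)
      _ = _ := by rw [hk]; ring
  refine (Finset.sum_le_sum hle).trans ?_
  simp only [Finset.sum_add_distrib, ← Finset.mul_sum]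
  rw [sum_boseEinstein, sum_id_mul_boseEinstein, sum_choose_two_mul_boseEinstein,
    sum_choose_three_mul_boseEinstein, ← he]
  have hm' : (1 : ℝ) ≤ m := by exact_mod_cast hm
  have h1 : ((m : ℝ) - 1) / (N + 2) ≤ e := by
    rw [he, div_le_div_iff₀ (by positivity) (by positivity)]
    nlinarith [(Nat.cast_nonneg N : (0 : ℝ) ≤ N)]
  have h10 : 0 ≤ ((m : ℝ) - 1) / (N + 2) := div_nonneg (by linarith) (by positivity)
  have h2 : ((m : ℝ) - 2) / (N + 3) ≤ e := by
    rw [he, div_le_div_iff₀ (by positivity) (by positivity)]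
    nlinarith [(Nat.cast_nonneg N : (0 : ℝ) ≤ N)]
  have h3 : ((m : ℝ) - 1) / (N + 2) * e ≤ e * e := mul_le_mul_of_nonneg_right h1 he0
  have h4 : ((m : ℝ) - 2) / (N + 3) * (((m : ℝ) - 1) / (N + 2) * e) ≤ e * (e * e) :=
    (mul_le_mul_of_nonneg_right h2 (mul_nonneg h10 he0)).trans
      (mul_le_mul_of_nonneg_left h3 he0)
  nlinarith

/-! ### Characteristic functions and Lyapunov's theorem -/

section CharacteristicFunctions

/-- Taylor's formula for |x| ≤ 1; beyond that each term separately is at most a multiple of |x|³. -/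
theorem norm_cexp_mul_I_sub_le (x : ℝ) :
    ‖Complex.exp (x * Complex.I) - (1 + x * Complex.I - x ^ 2 / 2)‖ ≤ 4 * |x| ^ 3 := by
  have hn : ‖(x : ℂ) * Complex.I‖ = |x| := by simp
  rcases le_or_gt |x| 1 with h | h
  · have := Complex.exp_bound (x := x * Complex.I) (n := 3) (by rwa [hn]) (by norm_num)
    rw [hn] at this
    have e : ∑ m ∈ Finset.range 3, ((x : ℂ) * Complex.I) ^ m / (m.factorial : ℂ) =
        1 + x * Complex.I - x ^ 2 / 2 := by
      simp [Finset.sum_range_succ, mul_pow]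
      ring
    rw [e] at this
    refine this.trans ?_
    have h3 : 0 ≤ |x| ^ 3 := by positivity
    norm_num [Nat.factorial]
    linarith
  · have h1 : ‖Complex.exp (x * Complex.I) - (1 + x * Complex.I - x ^ 2 / 2)‖ ≤
        1 + (1 + |x| + |x| ^ 2 / 2) := by
      refine (norm_sub_le _ _).trans (add_le_add (Complex.norm_exp_ofReal_mul_I x).le ?_)
      refine (norm_sub_le _ _).trans (add_le_add ?_ ?_)
      · exact (norm_add_le _ _).trans (by simp)
      · simp
    have h2 : |x| ≤ |x| ^ 3 := le_self_pow₀ h.le (by norm_num)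
    have h3 : |x| ^ 2 ≤ |x| ^ 3 := pow_le_pow_right₀ h.le (by norm_num)
    linarith

theorem abs_exp_neg_sub_le {y : ℝ} (hy : 0 ≤ y) : |Real.exp (-y) - (1 - y)| ≤ y ^ 2 := by
  have hl := Real.add_one_le_exp (-y)
  rcases le_or_gt y 1 with h | h
  · have := Real.norm_exp_sub_one_sub_id_le (x := -y) (by rwa [norm_neg, Real.norm_of_nonneg hy])
    rw [norm_neg, Real.norm_eq_abs, Real.norm_eq_abs, sq_abs] at this
    convert this using 2
    ring
  · have : Real.exp (-y) ≤ 1 := Real.exp_le_one_iff.2 (by linarith)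
    rw [abs_of_nonneg (by linarith)]
    nlinarith

/-- Exchange the factors one at a time; the remaining ones have norm at most 1. -/
theorem norm_prod_sub_prod_le {ι : Type*} (s : Finset ι) (a b : ι → ℂ) (ha : ∀ i ∈ s, ‖a i‖ ≤ 1)
    (hb : ∀ i ∈ s, ‖b i‖ ≤ 1) :
    ‖∏ i ∈ s, a i - ∏ i ∈ s, b i‖ ≤ ∑ i ∈ s, ‖a i - b i‖ := by
  classical
  induction s using Finset.induction_on with
  | empty => simp
  | insert i s hi ih =>
    have ha' : ∀ j ∈ s, ‖a j‖ ≤ 1 := fun j hj => ha j (Finset.mem_insert_of_mem hj)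
    have hb' : ∀ j ∈ s, ‖b j‖ ≤ 1 := fun j hj => hb j (Finset.mem_insert_of_mem hj)
    rw [Finset.prod_insert hi, Finset.prod_insert hi, Finset.sum_insert hi]
    have e : a i * ∏ j ∈ s, a j - b i * ∏ j ∈ s, b j =
        (a i - b i) * ∏ j ∈ s, a j + b i * (∏ j ∈ s, a j - ∏ j ∈ s, b j) := by ring
    rw [e]
    refine (norm_add_le _ _).trans (add_le_add ?_ ?_)
    · rw [norm_mul]
      refine mul_le_of_le_one_right (norm_nonneg _) ?_
      rw [norm_prod]
      exact Finset.prod_le_one (fun _ _ => norm_nonneg _) ha'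
    · rw [norm_mul]
      exact (mul_le_of_le_one_left (norm_nonneg _) (hb i (Finset.mem_insert_self i s))).trans
        (ih ha' hb')

/-- The characteristic function of a finitely supported law on `ℝ`. -/
noncomputable def finiteCharFun {ι : Type*} (s : Finset ι) (p d : ι → ℝ) (u : ℝ) : ℂ :=
  ∑ k ∈ s, (p k : ℂ) * Complex.exp ((u * d k : ℝ) * Complex.I)

theorem norm_finiteCharFun_le_one {ι : Type*} {s : Finset ι} {p : ι → ℝ} (d : ι → ℝ)
    (hp : ∀ k, 0 ≤ p k) (h1 : ∑ k ∈ s, p k = 1) (u : ℝ) : ‖finiteCharFun s p d u‖ ≤ 1 := by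
  refine (norm_sum_le _ _).trans ?_
  rw [← h1]
  refine Finset.sum_le_sum fun k _ => ?_
  rw [norm_mul, Complex.norm_exp_ofReal_mul_I, mul_one, Complex.norm_real,
    Real.norm_of_nonneg (hp k)]

/-- Both sides are compared with the common second-order expansion 1 - u²v/2, in which the linear
term vanishes by centring. -/
theorem norm_finiteCharFun_sub_exp_le {ι : Type*} {s : Finset ι} {p d : ι → ℝ}
    (hp : ∀ k, 0 ≤ p k) (h1 : ∑ k ∈ s, p k = 1) (h0 : ∑ k ∈ s, d k * p k = 0) (u : ℝ) :
    ‖finiteCharFun s p d u - (Real.exp (-(u ^ 2 * (∑ k ∈ s, d k ^ 2 * p k) / 2)) : ℝ)‖ ≤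
      4 * |u| ^ 3 * ∑ k ∈ s, |d k| ^ 3 * p k +
        (u ^ 2 * (∑ k ∈ s, d k ^ 2 * p k) / 2) ^ 2 := by
  set v := ∑ k ∈ s, d k ^ 2 * p k with hv
  have hv0 : 0 ≤ v := Finset.sum_nonneg fun k _ => mul_nonneg (sq_nonneg _) (hp k)
  have e : ((1 - u ^ 2 * v / 2 : ℝ) : ℂ) = ∑ k ∈ s, (p k : ℂ) *
      (1 + (u * d k : ℝ) * Complex.I - (u * d k : ℝ) ^ 2 / 2) := by
    have h : ∀ k, (p k : ℂ) * (1 + (u * d k : ℝ) * Complex.I - (u * d k : ℝ) ^ 2 / 2) =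
        (p k : ℂ) + u * Complex.I * ((d k * p k : ℝ) : ℂ) -
          u ^ 2 / 2 * ((d k ^ 2 * p k : ℝ) : ℂ) := by
      intro k
      push_cast
      ring
    simp only [h, Finset.sum_add_distrib, Finset.sum_sub_distrib, ← Finset.mul_sum]
    rw [← Complex.ofReal_sum, ← Complex.ofReal_sum, ← Complex.ofReal_sum, h1, h0, ← hv]
    push_cast
    ring
  have hA : ‖finiteCharFun s p d u - ((1 - u ^ 2 * v / 2 : ℝ) : ℂ)‖ ≤
      4 * |u| ^ 3 * ∑ k ∈ s, |d k| ^ 3 * p k := by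
    rw [e, finiteCharFun, ← Finset.sum_sub_distrib, Finset.mul_sum]
    refine (norm_sum_le _ _).trans (Finset.sum_le_sum fun k _ => ?_)
    rw [← mul_sub, norm_mul, Complex.norm_real, Real.norm_of_nonneg (hp k)]
    refine (mul_le_mul_of_nonneg_left (norm_cexp_mul_I_sub_le (u * d k)) (hp k)).trans ?_
    rw [abs_mul, mul_pow]
    exact le_of_eq (by ring)
  have hB : ‖((1 - u ^ 2 * v / 2 : ℝ) : ℂ) - (Real.exp (-(u ^ 2 * v / 2)) : ℝ)‖ ≤
      (u ^ 2 * v / 2) ^ 2 := by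
    rw [← Complex.ofReal_sub, Complex.norm_real, Real.norm_eq_abs, abs_sub_comm]
    exact abs_exp_neg_sub_le (by positivity)
  exact (norm_sub_le_norm_sub_add_norm_sub _ _ _).trans (add_le_add hA hB)

/-- Lyapunov's central limit theorem, for characteristic functions: the row products converge
to the characteristic function of the normal law. -/
theorem tendsto_prod_charFun {ψ : ℕ → ℝ → ℂ} {v ρ : ℕ → ℝ} {B D : ℝ}
    (hψ : ∀ s u, ‖ψ s u‖ ≤ 1)
    (hψv : ∀ s u, ‖ψ s u - (Real.exp (-(u ^ 2 * v s / 2)) : ℝ)‖ ≤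
      4 * |u| ^ 3 * ρ s + (u ^ 2 * v s / 2) ^ 2)
    (hv0 : ∀ s, 0 ≤ v s) (hvB : ∀ s, v s ≤ B) (hρ : ∀ s, ρ s ≤ D * v s)
    (hV : Tendsto (fun T => ∑ s ∈ Finset.range T, v s) atTop atTop) (u : ℝ) :
    Tendsto (fun T => ∏ s ∈ Finset.range T, ψ s (u / √(∑ s ∈ Finset.range T, v s))) atTop
      (𝓝 (Real.exp (-(u ^ 2 / 2)) : ℝ)) := by
  set V : ℕ → ℝ := fun T => ∑ s ∈ Finset.range T, v s with hVdef
  have hbound : ∀ᶠ T in atTop,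
      ‖∏ s ∈ Finset.range T, ψ s (u / √(V T)) - (Real.exp (-(u ^ 2 / 2)) : ℝ)‖ ≤
        4 * |u| ^ 3 * D * (√(V T))⁻¹ + u ^ 4 / 4 * B * (V T)⁻¹ := by
    filter_upwards [hV.eventually_gt_atTop 0] with T hT
    have hT : 0 < V T := hT
    have hs : 0 < √(V T) := Real.sqrt_pos.2 hT
    have hsq : √(V T) ^ 2 = V T := Real.sq_sqrt hT.le
    -- The variances add up to `V T`, so the normal characteristic function splits exactly into one
    -- factor per step.
    have hprod : ((Real.exp (-(u ^ 2 / 2)) : ℝ) : ℂ) = ∏ s ∈ Finset.range T,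
        ((Real.exp (-((u / √(V T)) ^ 2 * v s / 2)) : ℝ) : ℂ) := by
      rw [← Complex.ofReal_prod, ← Real.exp_sum]
      congr 2
      have : ∀ s, -((u / √(V T)) ^ 2 * v s / 2) = -(u ^ 2 / V T / 2) * v s := by
        intro s
        rw [div_pow, hsq]
        ring
      simp only [this, ← Finset.mul_sum]
      change _ = _ * V T
      field_simp
    rw [hprod]
    refine (norm_prod_sub_prod_le _ _ _ (fun s _ => hψ s _) fun s _ => ?_).trans ?_
    · rw [Complex.norm_real, Real.norm_of_nonneg (Real.exp_pos _).le, Real.exp_le_one_iff]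
      have := hv0 s
      have : 0 ≤ (u / √(V T)) ^ 2 * v s / 2 := by positivity
      linarith
    -- Each error is made proportional to `v s`, so the sum costs one factor `V T` and still leaves
    -- negative powers of it.
    have hterm : ∀ s ∈ Finset.range T, ‖ψ s (u / √(V T)) -
        ((Real.exp (-((u / √(V T)) ^ 2 * v s / 2)) : ℝ) : ℂ)‖ ≤
        (4 * |u| ^ 3 * D / √(V T) ^ 3 + u ^ 4 / 4 * B / V T ^ 2) * v s := by
      intro s _
      refine (hψv s _).trans ?_
      have h1 : 4 * |u / √(V T)| ^ 3 * ρ s ≤ 4 * |u| ^ 3 * D / √(V T) ^ 3 * v s := by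
        refine (mul_le_mul_of_nonneg_left (hρ s) (by positivity)).trans (le_of_eq ?_)
        rw [abs_div, abs_of_pos hs, div_pow]
        ring
      have h2 : ((u / √(V T)) ^ 2 * v s / 2) ^ 2 ≤ u ^ 4 / 4 * B / V T ^ 2 * v s := by
        have : ((u / √(V T)) ^ 2 * v s / 2) ^ 2 = u ^ 4 / 4 / V T ^ 2 * (v s * v s) := by
          rw [div_pow u, hsq]
          ring
        rw [this]
        refine (mul_le_mul_of_nonneg_left (mul_le_mul_of_nonneg_right (hvB s) (hv0 s))
          (by positivity)).trans (le_of_eq ?_)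
        ring
      rw [add_mul]
      exact add_le_add h1 h2
    refine (Finset.sum_le_sum hterm).trans (le_of_eq ?_)
    rw [← Finset.mul_sum]
    change _ * V T = _
    have h3 : √(V T) ^ 3 = √(V T) * V T := by rw [pow_succ', hsq]
    rw [h3]
    field_simp
  have hlim : Tendsto (fun T => 4 * |u| ^ 3 * D * (√(V T))⁻¹ + u ^ 4 / 4 * B * (V T)⁻¹) atTop
      (𝓝 0) := by
    have h1 := (tendsto_inv_atTop_zero.comp (Real.tendsto_sqrt_atTop.comp hV)).const_mul
      (4 * |u| ^ 3 * D)
    have h2 := (tendsto_inv_atTop_zero.comp hV).const_mul (u ^ 4 / 4 * B)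
    simpa using h1.add h2
  rw [tendsto_iff_norm_sub_tendsto_zero]
  exact squeeze_zero' (.of_forall fun _ => norm_nonneg _) hbound hlim

end CharacteristicFunctions

/-! ### A strong law from second moments -/

section StrongLaw

variable {Ω : Type*} [MeasurableSpace Ω] {P : Measure Ω}

/-- The sum of the squares has finite expectation, so it converges almost surely and its terms tend
to zero. -/
theorem ae_tendsto_zero_of_summable_integral_sq {S : ℕ → Ω → ℝ} {c : ℕ → ℝ}
    (hS : ∀ k, AEStronglyMeasurable (S k) P) (hint : ∀ k, Integrable (fun ω => S k ω ^ 2) P)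
    (hle : ∀ k, ∫ ω, S k ω ^ 2 ∂P ≤ c k) (hc : Summable c) :
    ∀ᵐ ω ∂P, Tendsto (fun k => S k ω) atTop (𝓝 0) := by
  have hmeas : ∀ k, AEMeasurable (fun ω => ENNReal.ofReal (S k ω ^ 2)) P := fun k =>
    ((hS k).aemeasurable.pow_const 2).ennreal_ofReal
  have hfin : ∫⁻ ω, ∑' k, ENNReal.ofReal (S k ω ^ 2) ∂P ≠ ⊤ := by
    rw [lintegral_tsum hmeas]
    have h1 : ∀ k, ∫⁻ ω, ENNReal.ofReal (S k ω ^ 2) ∂P ≤ ENNReal.ofReal (c k) := fun k => by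
      rw [← ofReal_integral_eq_lintegral_ofReal (hint k) (.of_forall fun _ => sq_nonneg _)]
      exact ENNReal.ofReal_le_ofReal (hle k)
    exact ne_top_of_le_ne_top hc.tsum_ofReal_ne_top (ENNReal.tsum_le_tsum h1)
  filter_upwards [ae_lt_top' (AEMeasurable.tsum hmeas) hfin] with ω hω
  have h := ENNReal.tendsto_atTop_zero_of_tsum_ne_top hω.ne
  have h' := (ENNReal.tendsto_toReal ENNReal.zero_ne_top).comp h
  have h2 : Tendsto (fun k => S k ω ^ 2) atTop (𝓝 0) := by
    simpa [Function.comp_def, ENNReal.toReal_ofReal, sq_nonneg] using h'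
  have h3 := h2.sqrt
  simp only [Real.sqrt_sq_eq_abs, Real.sqrt_zero] at h3
  exact (tendsto_zero_iff_abs_tendsto_zero _).2 h3

/-- A strong law of large numbers for a nondecreasing process whose variance is at most
proportional to its mean. -/
theorem ae_tendsto_div_of_variance_le {K : ℕ → Ω → ℝ} {a : ℕ → ℝ} {A B : ℝ}
    (hmeas : ∀ t, AEStronglyMeasurable (K t) P)
    (hint : ∀ t, Integrable (fun ω => (K t ω - a t) ^ 2) P)
    (hvar : ∀ t, ∫ ω, (K t ω - a t) ^ 2 ∂P ≤ A * a t) (hA : 0 ≤ A)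
    (hmono : ∀ᵐ ω ∂P, Monotone fun t => K t ω) (hpos : ∀ t ω, 0 ≤ K t ω)
    (ha0 : a 0 = 0) (ha : Monotone a) (hstep : ∀ t, a (t + 1) ≤ a t + B)
    (htop : Tendsto a atTop atTop) :
    ∀ᵐ ω ∂P, Tendsto (fun t => K t ω / a t) atTop (𝓝 1) := by
  classical
  have hex : ∀ k : ℕ, ∃ t, ((k : ℝ) + 1) ^ 2 ≤ a t := fun k =>
    (htop.eventually_ge_atTop _).exists
  -- The first time at which the mean reaches (k+1)²; since its steps are at most `B`, it overshoots
  -- by at most `B`.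
  let T : ℕ → ℕ := fun k => Nat.find (hex k)
  have hT : ∀ k : ℕ, ((k : ℝ) + 1) ^ 2 ≤ a (T k) := fun k => Nat.find_spec (hex k)
  have hB : 0 ≤ B := by
    have := ha (Nat.le_succ 0)
    have := hstep 0
    simp only [Nat.succ_eq_add_one] at *
    linarith
  have hTle : ∀ k : ℕ, a (T k) ≤ ((k : ℝ) + 1) ^ 2 + B := by
    intro k
    have h0 : T k ≠ 0 := by
      intro h
      have h1 := hT k
      rw [h, ha0] at h1
      have : (0 : ℝ) < ((k : ℝ) + 1) ^ 2 := by positivity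
      linarith
    obtain ⟨t, ht⟩ := Nat.exists_eq_succ_of_ne_zero h0
    have h1 : a t < ((k : ℝ) + 1) ^ 2 := not_le.1 (Nat.find_min (hex k) (by
      change t < T k
      omega))
    have := hstep t
    rw [ht, Nat.succ_eq_add_one]
    linarith
  -- The variance at `T k` is at most A(1+B)(k+1)², and the normalisation divides it by (k+1)⁴.
  have hsum : Summable fun k : ℕ => A * (1 + B) * (1 / ((k : ℝ) + 1) ^ 2) := by
    refine Summable.mul_left _ ?_
    have := (summable_nat_add_iff 1).2 (Real.summable_one_div_nat_pow.2 one_lt_two)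
    simpa using this
  have hS := ae_tendsto_zero_of_summable_integral_sq (P := P)
    (S := fun k ω => (K (T k) ω - a (T k)) / ((k : ℝ) + 1) ^ 2)
    (c := fun k : ℕ => A * (1 + B) * (1 / ((k : ℝ) + 1) ^ 2))
    (fun k => (((hmeas _).aemeasurable.sub_const _).div_const _).aestronglyMeasurable)
    (fun k => by
      simp only [div_pow]
      exact (hint _).div_const _)
    (fun k => by
      simp only [div_pow]
      rw [integral_div]
      have hk : (1 : ℝ) ≤ ((k : ℝ) + 1) ^ 2 := one_le_pow₀ (by
        have : (0 : ℝ) ≤ k := by positivity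
        linarith)
      have h1 : ∫ ω, (K (T k) ω - a (T k)) ^ 2 ∂P ≤ A * ((1 + B) * ((k : ℝ) + 1) ^ 2) := by
        refine (hvar _).trans (mul_le_mul_of_nonneg_left ((hTle k).trans ?_) hA)
        nlinarith
      rw [div_le_iff₀ (by positivity)]
      refine h1.trans (le_of_eq ?_)
      field_simp) hsum
  have hk0 : Tendsto (fun k : ℕ => 1 / ((k : ℝ) + 1)) atTop (𝓝 0) :=
    tendsto_one_div_add_atTop_nhds_zero_nat
  have hk2 : Tendsto (fun k : ℕ => B * (1 / ((k : ℝ) + 1)) ^ 2) atTop (𝓝 0) := by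
    simpa using (hk0.pow 2).const_mul B
  have haT : Tendsto (fun k : ℕ => a (T k) / ((k : ℝ) + 1) ^ 2) atTop (𝓝 1) := by
    have h1 : Tendsto (fun k : ℕ => 1 + B * (1 / ((k : ℝ) + 1)) ^ 2) atTop (𝓝 1) := by
      simpa using hk2.const_add 1
    refine tendsto_of_tendsto_of_tendsto_of_le_of_le tendsto_const_nhds h1 (fun k => ?_)
      fun k => ?_
    · change 1 ≤ a (T k) / ((k : ℝ) + 1) ^ 2
      rw [le_div_iff₀ (by positivity), one_mul]
      exact hT k
    · change a (T k) / ((k : ℝ) + 1) ^ 2 ≤ 1 + B * (1 / ((k : ℝ) + 1)) ^ 2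
      rw [div_le_iff₀ (by positivity)]
      refine (hTle k).trans (le_of_eq ?_)
      field_simp
  have hratio : Tendsto (fun k : ℕ => (((k : ℝ) + 2) / (k + 1)) ^ 2) atTop (𝓝 1) := by
    have h1 : Tendsto (fun k : ℕ => (1 + 1 / ((k : ℝ) + 1)) ^ 2) atTop (𝓝 1) := by
      simpa using (hk0.const_add (1 : ℝ)).pow 2
    refine h1.congr fun k => ?_
    congr 1
    field_simp
    ring
  -- The index with (κ+1)² ≤ a t < (κ+2)² once a t ≥ 1, so that t lies between `T κ` and `T (κ +
  -- 1)`. Monotonicity then sandwiches the ratio, at the cost of a factor ((κ+2)/(κ+1))² tending to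
  -- 1.
  let κ : ℕ → ℕ := fun t => Nat.sqrt ⌊a t⌋₊ - 1
  have hκ : Tendsto κ atTop atTop := by
    have hsqrt : Tendsto Nat.sqrt atTop atTop :=
      tendsto_atTop_atTop.2 fun b => ⟨b * b, fun x hx => Nat.le_sqrt.2 hx⟩
    exact (tendsto_sub_atTop_nat 1).comp (hsqrt.comp (tendsto_nat_floor_atTop.comp htop))
  filter_upwards [hS, hmono] with ω hω hm
  have hR : Tendsto (fun k : ℕ => K (T k) ω / ((k : ℝ) + 1) ^ 2) atTop (𝓝 1) := by
    have := hω.add haT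
    rw [zero_add] at this
    refine this.congr fun k => ?_
    rw [← add_div, sub_add_cancel]
  have hupper : Tendsto (fun k : ℕ => K (T (k + 1)) ω / (((k + 1 : ℕ) : ℝ) + 1) ^ 2 *
      (((k : ℝ) + 2) / (k + 1)) ^ 2) atTop (𝓝 1) := by
    simpa using ((tendsto_add_atTop_iff_nat 1).2 hR).mul hratio
  have hlower : Tendsto (fun k : ℕ => K (T k) ω / ((k : ℝ) + 1) ^ 2 /
      (((k : ℝ) + 2) / (k + 1)) ^ 2) atTop (𝓝 1) := by
    have := hR.div hratio one_ne_zero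
    rwa [div_one] at this
  have hbounds : ∀ᶠ t in atTop, ((κ t : ℝ) + 1) ^ 2 ≤ a t ∧ a t < ((κ t : ℝ) + 2) ^ 2 := by
    filter_upwards [htop.eventually_ge_atTop 1] with t ht
    have h1 : 1 ≤ Nat.sqrt ⌊a t⌋₊ := by
      rw [Nat.le_sqrt]
      exact Nat.le_floor (by simpa using ht)
    have h2 : κ t + 1 = Nat.sqrt ⌊a t⌋₊ := Nat.sub_add_cancel h1
    have h3 := Nat.sqrt_le' ⌊a t⌋₊
    have h4 := Nat.lt_succ_sqrt' ⌊a t⌋₊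
    rw [← h2] at h3 h4
    constructor
    · have := (Nat.le_floor_iff (by linarith)).1 h3
      push_cast at this
      exact this
    · have := (Nat.floor_lt (by linarith)).1 h4
      push_cast at this
      calc a t < ((κ t : ℝ) + 1 + 1) ^ 2 := this
        _ = _ := by ring
  refine tendsto_of_tendsto_of_tendsto_of_le_of_le' (hlower.comp hκ) (hupper.comp hκ) ?_ ?_
  · filter_upwards [hbounds] with t ⟨h1, h2⟩
    have hk : (0 : ℝ) < ((κ t : ℝ) + 1) ^ 2 := by positivity
    have hTt : T (κ t) ≤ t := Nat.find_min' (hex _) h1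
    have hKK : K (T (κ t)) ω ≤ K t ω := hm hTt
    have e : K (T (κ t)) ω / ((κ t : ℝ) + 1) ^ 2 / (((κ t : ℝ) + 2) / (κ t + 1)) ^ 2 =
        K (T (κ t)) ω / ((κ t : ℝ) + 2) ^ 2 := by
      field_simp
    simp only [Function.comp_apply]
    rw [e]
    exact div_le_div₀ (hpos _ _) hKK (hk.trans_le h1) h2.le
  · filter_upwards [hbounds] with t ⟨h1, h2⟩
    have hk : (0 : ℝ) < ((κ t : ℝ) + 1) ^ 2 := by positivity
    have htT : t ≤ T (κ t + 1) := by
      by_contra h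
      have h3 := hT (κ t + 1)
      have h4 := ha (not_le.1 h).le
      push_cast at h3
      rw [show (κ t : ℝ) + 1 + 1 = κ t + 2 by ring] at h3
      linarith
    have hKK : K t ω ≤ K (T (κ t + 1)) ω := hm htT
    have e : K (T (κ t + 1)) ω / (((κ t + 1 : ℕ) : ℝ) + 1) ^ 2 *
        (((κ t : ℝ) + 2) / (κ t + 1)) ^ 2 = K (T (κ t + 1)) ω / ((κ t : ℝ) + 1) ^ 2 := by
      push_cast
      rw [show (κ t : ℝ) + 1 + 1 = κ t + 2 by ring]
      field_simp
    simp only [Function.comp_apply]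
    rw [e]
    exact div_le_div₀ (hpos _ _) hKK hk h1

end StrongLaw

/-! ### Comparison of mean, variance and third moment of a step -/

/-- The mean number of cycles formed at step `s + 1`, for `θ = 1`. -/
noncomputable def stepMean (n : ℕ → ℕ) (s : ℕ) : ℝ := (n (s + 1) : ℝ) / (total n s + 1)

/-- The variance of the number of cycles formed at step `s + 1`, for `θ = 1`. -/
noncomputable def stepVar (n : ℕ → ℕ) (s : ℕ) : ℝ :=
  (n (s + 1) : ℝ) * total n s * (total n s + 1 + n (s + 1)) /
    ((total n s + 1) ^ 2 * (total n s + 2))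

/-- The third absolute central moment of the number of cycles formed at step `s + 1`, for
`θ = 1`. -/
noncomputable def stepThird (n : ℕ → ℕ) (s : ℕ) : ℝ :=
  ∑ k ∈ Finset.range (n (s + 1) + 1),
    |(k : ℝ) - stepMean n s| ^ 3 * boseEinstein (total n s) (n (s + 1)) k

/-- The characteristic function of the centred number of cycles formed at step `s + 1`, for
`θ = 1`. -/
noncomputable def stepCharFun (n : ℕ → ℕ) (s : ℕ) (u : ℝ) : ℂ :=
  finiteCharFun (Finset.range (n (s + 1) + 1)) (boseEinstein (total n s) (n (s + 1)))
    (fun k => (k : ℝ) - stepMean n s) u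

theorem stepMean_nonneg (n : ℕ → ℕ) (s : ℕ) : 0 ≤ stepMean n s := by
  unfold stepMean; positivity

theorem stepVar_nonneg (n : ℕ → ℕ) (s : ℕ) : 0 ≤ stepVar n s := by
  unfold stepVar; positivity

theorem stepProb_one_succ (n : ℕ → ℕ) (s k : ℕ) :
    stepProb n 1 (s + 1) k = boseEinstein (total n s) (n (s + 1)) k := stepProb_one n (s + 1) k

theorem sum_sub_stepMean (n : ℕ → ℕ) (s : ℕ) :
    ∑ k ∈ Finset.range (n (s + 1) + 1),
      ((k : ℝ) - stepMean n s) * boseEinstein (total n s) (n (s + 1)) k = 0 := by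
  simp only [sub_mul, Finset.sum_sub_distrib, ← Finset.mul_sum]
  rw [sum_boseEinstein, sum_id_mul_boseEinstein, stepMean]
  ring

theorem sum_sq_sub_stepMean (n : ℕ → ℕ) (s : ℕ) :
    ∑ k ∈ Finset.range (n (s + 1) + 1),
      ((k : ℝ) - stepMean n s) ^ 2 * boseEinstein (total n s) (n (s + 1)) k = stepVar n s :=
  sum_sq_sub_mul_boseEinstein (total n s) (n (s + 1))

theorem norm_stepCharFun_le_one (n : ℕ → ℕ) (s : ℕ) (u : ℝ) : ‖stepCharFun n s u‖ ≤ 1 :=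
  norm_finiteCharFun_le_one _ (boseEinstein_nonneg _ _) (sum_boseEinstein _ _) u

theorem norm_stepCharFun_sub_exp_le (n : ℕ → ℕ) (s : ℕ) (u : ℝ) :
    ‖stepCharFun n s u - (Real.exp (-(u ^ 2 * stepVar n s / 2)) : ℝ)‖ ≤
      4 * |u| ^ 3 * stepThird n s + (u ^ 2 * stepVar n s / 2) ^ 2 := by
  have := norm_finiteCharFun_sub_exp_le (boseEinstein_nonneg (total n s) (n (s + 1)))
    (sum_boseEinstein _ _) (sum_sub_stepMean n s) u
  rwa [sum_sq_sub_stepMean] at this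

section Bounds

variable {n : ℕ → ℕ}

theorem total_zero (n : ℕ → ℕ) : total n 0 = 0 := by simp [total]

theorem total_pos (hn : ∀ t, 1 ≤ t → 1 ≤ n t) {s : ℕ} (hs : 1 ≤ s) : 1 ≤ total n s :=
  (hn 1 le_rfl).trans (Finset.single_le_sum (f := n) (fun _ _ => Nat.zero_le _)
    (Finset.mem_Icc.2 ⟨le_rfl, hs⟩))

theorem stepVar_zero (n : ℕ → ℕ) : stepVar n 0 = 0 := by simp [stepVar, total_zero]

theorem stepThird_zero (n : ℕ → ℕ) : stepThird n 0 = 0 := by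
  have := sum_abs_cube_mul_boseEinstein_zero (n 1)
  simpa [stepThird, stepMean, total_zero] using this

/-- For N ≥ 1 one has N + 1 ≤ 2N; at `s = 0` the left side is a division by zero, hence 0. -/
theorem div_total_le_stepMean (hn : ∀ t, 1 ≤ t → 1 ≤ n t) (s : ℕ) :
    (n (s + 1) : ℝ) / total n s ≤ 2 * stepMean n s := by
  rcases Nat.eq_zero_or_pos s with rfl | hs
  · have := stepMean_nonneg n 0
    simp [total_zero, this]
  · have hN : (1 : ℝ) ≤ total n s := by exact_mod_cast total_pos hn hs
    rw [stepMean, ← mul_div_assoc, div_le_div_iff₀ (by linarith) (by linarith)]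
    nlinarith [(Nat.cast_nonneg (n (s + 1)) : (0 : ℝ) ≤ n (s + 1))]

/-- The variance over the mean is at least N/(N+2), which is at least 1/3 for N ≥ 1. -/
theorem stepMean_le_stepVar (hn : ∀ t, 1 ≤ t → 1 ≤ n t) {s : ℕ} (hs : 1 ≤ s) :
    stepMean n s ≤ 3 * stepVar n s := by
  have hN : (1 : ℝ) ≤ total n s := by exact_mod_cast total_pos hn hs
  have e : stepVar n s = stepMean n s *
      (total n s * (total n s + 1 + n (s + 1)) / ((total n s + 1) * (total n s + 2))) := by
    rw [stepVar, stepMean]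
    field_simp
  have h1 : (1 : ℝ) / 3 ≤
      total n s * (total n s + 1 + n (s + 1)) / ((total n s + 1) * (total n s + 2)) := by
    rw [div_le_div_iff₀ (by norm_num) (by positivity)]
    have : (0 : ℝ) ≤ total n s * n (s + 1) := by positivity
    nlinarith
  have := mul_le_mul_of_nonneg_left h1 (stepMean_nonneg n s)
  rw [e]
  linarith

theorem div_total_le_stepVar (hn : ∀ t, 1 ≤ t → 1 ≤ n t) (s : ℕ) :
    (n (s + 1) : ℝ) / total n s ≤ 6 * stepVar n s := by
  rcases Nat.eq_zero_or_pos s with rfl | hs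
  · simp [total_zero, stepVar_zero]
  · linarith [div_total_le_stepMean hn s, stepMean_le_stepVar hn hs]

theorem stepMean_le {C : ℝ} (hC : ∀ t, 2 ≤ t → (n t : ℝ) ≤ C * total n (t - 1)) (hC0 : 0 ≤ C)
    {s : ℕ} (hs : 1 ≤ s) : stepMean n s ≤ C := by
  have h : (n (s + 1) : ℝ) ≤ C * total n s := hC (s + 1) (by omega)
  rw [stepMean, div_le_iff₀ (by positivity)]
  linarith

/-- The variance is e(1+e)N/(N+2) with e ≤ C. The first step, whose mean need not be bounded by C,
has variance 0. -/
theorem stepVar_le_mul_stepMean {C : ℝ} (hC : ∀ t, 2 ≤ t → (n t : ℝ) ≤ C * total n (t - 1))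
    (hC0 : 0 ≤ C) (s : ℕ) : stepVar n s ≤ (1 + C) * stepMean n s := by
  rcases Nat.eq_zero_or_pos s with rfl | hs
  · rw [stepVar_zero]
    exact mul_nonneg (by linarith) (stepMean_nonneg n 0)
  · have e : stepVar n s = stepMean n s *
        ((total n s / (total n s + 2)) * (1 + stepMean n s)) := by
      rw [stepVar, stepMean]
      field_simp
    have h1 : (total n s : ℝ) / (total n s + 2) ≤ 1 := by
      rw [div_le_one (by positivity)]
      linarith
    have h2 := stepMean_le hC hC0 hs
    have h0 := stepMean_nonneg n s
    rw [e, mul_comm]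
    refine mul_le_mul_of_nonneg_right ?_ h0
    exact (mul_le_of_le_one_left (by linarith) h1).trans (by linarith)

theorem stepVar_le {C : ℝ} (hC : ∀ t, 2 ≤ t → (n t : ℝ) ≤ C * total n (t - 1))
    (hC0 : 0 ≤ C) (s : ℕ) : stepVar n s ≤ (1 + C) * C := by
  rcases Nat.eq_zero_or_pos s with rfl | hs
  · rw [stepVar_zero]
    positivity
  · exact (stepVar_le_mul_stepMean hC hC0 s).trans
      (mul_le_mul_of_nonneg_left (stepMean_le hC hC0 hs) (by linarith))

/-- One factor e is taken out of the cubic bound and exchanged for three times the variance; the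
other factors e are at most C. -/
theorem stepThird_le {C : ℝ} (hn : ∀ t, 1 ≤ t → 1 ≤ n t)
    (hC : ∀ t, 2 ≤ t → (n t : ℝ) ≤ C * total n (t - 1)) (hC0 : 0 ≤ C) (s : ℕ) :
    stepThird n s ≤ (7 * C ^ 2 + 6 * C + 1) * 3 * stepVar n s := by
  rcases Nat.eq_zero_or_pos s with rfl | hs
  · simp [stepVar_zero, stepThird_zero]
  · have h : stepThird n s ≤ 7 * stepMean n s ^ 3 + 6 * stepMean n s ^ 2 + stepMean n s :=
      sum_abs_cube_mul_boseEinstein_le (N := total n s) (hn (s + 1) (by omega))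
    have h0 := stepMean_nonneg n s
    have h1 := stepMean_le hC hC0 hs
    have h2 := stepMean_le_stepVar hn hs
    have h3 : stepMean n s ^ 2 ≤ C ^ 2 := pow_le_pow_left₀ h0 h1 2
    calc _ ≤ 7 * stepMean n s ^ 3 + 6 * stepMean n s ^ 2 + stepMean n s := h
      _ = (7 * stepMean n s ^ 2 + 6 * stepMean n s + 1) * stepMean n s := by ring
      _ ≤ (7 * C ^ 2 + 6 * C + 1) * stepMean n s :=
        mul_le_mul_of_nonneg_right (by linarith) h0
      _ ≤ (7 * C ^ 2 + 6 * C + 1) * (3 * stepVar n s) :=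
        mul_le_mul_of_nonneg_left h2 (by positivity)
      _ = _ := by ring

/-- The extra term `s = 0` on the right is `n 1 / 0 = 0`. -/
theorem sum_Icc_two_eq (n : ℕ → ℕ) (T : ℕ) :
    ∑ t ∈ Finset.Icc 2 T, (n t : ℝ) / total n (t - 1) =
      ∑ s ∈ Finset.range T, (n (s + 1) : ℝ) / total n s := by
  induction T with
  | zero => simp
  | succ T ih =>
    rw [Finset.sum_range_succ]
    rcases Nat.eq_zero_or_pos T with rfl | hT
    · simp [total_zero]
    · rw [Finset.sum_Icc_succ_top (by omega), ih, Nat.add_sub_cancel]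

end Bounds

/-! ### Mean, variance and characteristic function of the cycle count -/

namespace IsMultisetCRP

variable {Ω : Type*} [MeasurableSpace Ω] {P : Measure Ω} [IsProbabilityMeasure P] {n : ℕ → ℕ}
  {θ : ℝ} {π : (t : ℕ) → Ω → MultisetPerm n t}

theorem integrable_comp (hπ : IsMultisetCRP P n θ π) {E : Type*} [NormedAddCommGroup E] (t : ℕ)
    (g : ℕ → E) : Integrable (fun ω => g (numCycles (π t ω).1)) P := by
  let _ : MeasurableSpace (MultisetPerm n t) := ⊤
  have hX : Measurable (π t) := measurable_to_countable' (hπ.measurableSet_eq t)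
  have : DiscreteMeasurableSpace (MultisetPerm n t) := ⟨fun _ => trivial⟩
  have hi : Integrable (fun w : MultisetPerm n t => g (numCycles w.1)) (P.map (π t)) :=
    .of_finite
  exact hi.comp_measurable hX

theorem integral_cycleCount (hπ : IsMultisetCRP P n 1 π) (t : ℕ) :
    ∫ ω, cycleCount π t ω ∂P = ∑ s ∈ Finset.range t, stepMean n s := by
  simp only [cycleCount]
  induction t with
  | zero => simp [numCycles_zero]
  | succ t ih =>
    rw [hπ.integral_numCycles_succ t (fun k => (k : ℝ)), Finset.sum_range_succ (stepMean n), ← ih]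
    have h : ∀ k : ℕ, ∫ ω, ((numCycles (π t ω).1 + k : ℕ) : ℝ) ∂P =
        ∫ ω, (numCycles (π t ω).1 : ℝ) ∂P + k := by
      intro k
      push_cast
      rw [integral_add (hπ.integrable_comp t (fun k => (k : ℝ))) (integrable_const _)]
      simp
    simp only [h, stepProb_one_succ, smul_eq_mul, mul_add, Finset.sum_add_distrib,
      ← Finset.sum_mul]
    rw [sum_boseEinstein, one_mul, stepMean, ← sum_id_mul_boseEinstein]
    simp only [mul_comm]

theorem integral_sq_sub (hπ : IsMultisetCRP P n 1 π) (t : ℕ) :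
    ∫ ω, (cycleCount π t ω - ∑ s ∈ Finset.range t, stepMean n s) ^ 2 ∂P =
      ∑ s ∈ Finset.range t, stepVar n s := by
  have hmean := hπ.integral_cycleCount
  simp only [cycleCount] at hmean ⊢
  induction t with
  | zero => simp [numCycles_zero]
  | succ t ih =>
    set a := ∑ s ∈ Finset.range t, stepMean n s with ha
    rw [hπ.integral_numCycles_succ t
      (fun k => ((k : ℝ) - ∑ s ∈ Finset.range (t + 1), stepMean n s) ^ 2),
      Finset.sum_range_succ (stepMean n), Finset.sum_range_succ (stepVar n), ← ha, ← ih]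
    have h : ∀ k : ℕ, ∫ ω, (((numCycles (π t ω).1 + k : ℕ) : ℝ) - (a + stepMean n t)) ^ 2 ∂P =
        ∫ ω, ((numCycles (π t ω).1 : ℝ) - a) ^ 2 ∂P + (k - stepMean n t) ^ 2 := by
      intro k
      have e : ∀ ω, (((numCycles (π t ω).1 + k : ℕ) : ℝ) - (a + stepMean n t)) ^ 2 =
          ((numCycles (π t ω).1 : ℝ) - a) ^ 2 +
            (2 * (k - stepMean n t) * ((numCycles (π t ω).1 : ℝ) - a) +
              (k - stepMean n t) ^ 2) := by
        intro ω
        push_cast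
        ring
      have hK := hπ.integrable_comp t (fun k => (k : ℝ))
      have h2 := hπ.integrable_comp t (fun k => ((k : ℝ) - a) ^ 2)
      have h3 := hπ.integrable_comp t (fun j => 2 * (k - stepMean n t) * ((j : ℝ) - a))
      have h4 := hπ.integrable_comp t (fun j => 2 * (k - stepMean n t) * ((j : ℝ) - a) +
        (k - stepMean n t) ^ 2)
      -- The cross term integrates to zero because the previous cycle count is centred at its mean
      -- `a`.
      simp only [e]
      rw [integral_add h2 h4, integral_add h3 (integrable_const _),
        integral_const_mul, integral_sub hK (integrable_const _), hmean]
      simp [ha]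
    simp only [h, stepProb_one_succ, smul_eq_mul, mul_add, Finset.sum_add_distrib,
      ← Finset.sum_mul]
    rw [sum_boseEinstein, one_mul, ← sum_sq_sub_stepMean]
    simp only [mul_comm]

theorem variance_cycleCount (hπ : IsMultisetCRP P n 1 π) (t : ℕ) :
    variance (cycleCount π t) P = ∑ s ∈ Finset.range t, stepVar n s := by
  have hm : AEMeasurable (cycleCount π t) P :=
    (hπ.integrable_comp t (fun k => (k : ℝ))).aemeasurable
  rw [variance_eq_integral hm, hπ.integral_cycleCount, hπ.integral_sq_sub]

/-- For fixed `k` the exponential of the increment is a constant factor, so each step contributes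
its own characteristic function. -/
theorem integral_cexp (hπ : IsMultisetCRP P n 1 π) (t : ℕ) (u : ℝ) :
    ∫ ω, Complex.exp ((u * (cycleCount π t ω - ∑ s ∈ Finset.range t, stepMean n s) : ℝ) *
      Complex.I) ∂P = ∏ s ∈ Finset.range t, stepCharFun n s u := by
  simp only [cycleCount]
  induction t with
  | zero => simp [numCycles_zero]
  | succ t ih =>
    set a := ∑ s ∈ Finset.range t, stepMean n s with ha
    rw [hπ.integral_numCycles_succ t (fun k => Complex.exp
      ((u * (k - ∑ s ∈ Finset.range (t + 1), stepMean n s) : ℝ) * Complex.I)),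
      Finset.sum_range_succ (stepMean n), Finset.prod_range_succ, ← ha, ← ih, stepCharFun, finiteCharFun,
      Finset.mul_sum]
    refine Finset.sum_congr rfl fun k _ => ?_
    have e : ∀ ω, Complex.exp
        ((u * (((numCycles (π t ω).1 + k : ℕ) : ℝ) - (a + stepMean n t)) : ℝ) * Complex.I) =
        Complex.exp ((u * (numCycles (π t ω).1 - a) : ℝ) * Complex.I) *
          Complex.exp ((u * (k - stepMean n t) : ℝ) * Complex.I) := by
      intro ω
      rw [← Complex.exp_add]
      congr 1
      push_cast
      ring
    simp only [e]
    rw [integral_mul_const, stepProb_one_succ, Complex.real_smul]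
    ring

end IsMultisetCRP

end MultisetCRP

/-! ### The limit theorems -/

open MultisetCRP in
theorem theorem4 {Ω : Type*} [MeasurableSpace Ω] (P : Measure Ω) [IsProbabilityMeasure P]
    (n : ℕ → ℕ) (hn : ∀ t, 1 ≤ t → 1 ≤ n t)
    (hO : ∃ C : ℝ, ∀ t, 2 ≤ t → (n t : ℝ) ≤ C * (MultisetCRP.total n (t - 1) : ℝ))
    (hsum : Tendsto (fun T : ℕ => ∑ t ∈ Finset.Icc 2 T,
      (n t : ℝ) / (MultisetCRP.total n (t - 1) : ℝ)) atTop atTop)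
    (π : (t : ℕ) → Ω → MultisetCRP.MultisetPerm n t)
    (hπ : MultisetCRP.IsMultisetCRP P n 1 π) :
    (∀ᵐ ω ∂P, Tendsto (fun t : ℕ =>
      MultisetCRP.cycleCount π t ω / ∫ ω', MultisetCRP.cycleCount π t ω' ∂P) atTop (𝓝 1)) ∧
    TendstoInDistribution (fun (t : ℕ) ω =>
        (MultisetCRP.cycleCount π t ω - ∫ ω', MultisetCRP.cycleCount π t ω' ∂P) /
          √(variance (MultisetCRP.cycleCount π t) P))
      atTop id (fun _ => P) (gaussianReal 0 1) := by
  obtain ⟨C, hC, hC0⟩ : ∃ C : ℝ, (∀ t, 2 ≤ t → (n t : ℝ) ≤ C * total n (t - 1)) ∧ 0 ≤ C := by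
    obtain ⟨C, hC⟩ := hO
    exact ⟨max C 0, fun t ht => (hC t ht).trans
      (mul_le_mul_of_nonneg_right (le_max_left _ _) (Nat.cast_nonneg _)), le_max_right _ _⟩
  simp only [sum_Icc_two_eq] at hsum
  have hmeanTop : Tendsto (fun T => ∑ s ∈ Finset.range T, stepMean n s) atTop atTop := by
    refine tendsto_atTop_mono (fun T => ?_) (hsum.atTop_mul_const (r := 1 / 2) (by norm_num))
    rw [Finset.sum_mul]
    exact Finset.sum_le_sum fun s _ => by linarith [div_total_le_stepMean hn s]
  have hvarTop : Tendsto (fun T => ∑ s ∈ Finset.range T, stepVar n s) atTop atTop := by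
    refine tendsto_atTop_mono (fun T => ?_) (hsum.atTop_mul_const (r := 1 / 6) (by norm_num))
    rw [Finset.sum_mul]
    exact Finset.sum_le_sum fun s _ => by linarith [div_total_le_stepVar hn s]
  have hmeas : ∀ t, AEMeasurable (cycleCount π t) P := fun t =>
    (hπ.integrable_comp t (fun k => (k : ℝ))).aemeasurable
  simp only [hπ.integral_cycleCount, hπ.variance_cycleCount]
  constructor
  -- `B` has to include `n 1`, the mean of the deterministic first step; all later means are at most
  -- `C`.
  · refine ae_tendsto_div_of_variance_le (A := 1 + C) (B := n 1 + C)
      (fun t => (hmeas t).aestronglyMeasurable)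
      (fun t => hπ.integrable_comp t
        (fun k => ((k : ℝ) - ∑ s ∈ Finset.range t, stepMean n s) ^ 2))
      (fun t => ?_) (by linarith) ?_ (fun t ω => Nat.cast_nonneg _) (by simp) ?_ (fun t => ?_)
      hmeanTop
    · rw [hπ.integral_sq_sub, Finset.mul_sum]
      exact Finset.sum_le_sum fun s _ => stepVar_le_mul_stepMean hC hC0 s
    · filter_upwards [ae_all_iff.2 hπ.ae_numCycles_le_succ] with ω hω
      exact monotone_nat_of_le_succ fun t => Nat.cast_le.2 (hω t)
    · refine monotone_nat_of_le_succ fun t => ?_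
      rw [Finset.sum_range_succ]
      linarith [stepMean_nonneg n t]
    · rw [Finset.sum_range_succ]
      have : stepMean n t ≤ n 1 + C := by
        rcases Nat.eq_zero_or_pos t with rfl | ht
        · simpa [stepMean, total_zero] using hC0
        · have : (0 : ℝ) ≤ n 1 := Nat.cast_nonneg _
          linarith [stepMean_le hC hC0 ht]
      linarith
  · have hmeas' : ∀ t, AEMeasurable (fun ω =>
        (cycleCount π t ω - ∑ s ∈ Finset.range t, stepMean n s) /
          √(∑ s ∈ Finset.range t, stepVar n s)) P := fun t =>
      ((hmeas t).sub_const _).div_const _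
    refine ⟨hmeas', aemeasurable_id, ?_⟩
    -- Lévy's continuity theorem reduces the normal limit to pointwise convergence of characteristic
    -- functions.
    refine ProbabilityMeasure.tendsto_iff_tendsto_charFun.2 fun u => ?_
    have hlim := tendsto_prod_charFun (norm_stepCharFun_le_one n) (norm_stepCharFun_sub_exp_le n)
      (stepVar_nonneg n) (stepVar_le hC hC0) (stepThird_le hn hC hC0) hvarTop u
    simp only [ProbabilityMeasure.coe_mk, Measure.map_id, charFun_gaussianReal]
    convert hlim using 1
    · funext t
      rw [charFun_apply_real, integral_map (hmeas' t) (by fun_prop), ← hπ.integral_cexp]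
      refine integral_congr_ae (.of_forall fun ω => ?_)
      refine congrArg Complex.exp ?_
      push_cast
      ring
    · push_cast
      simp
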